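/- Let $d\ge 2$, $0<\delta<\pi/2$, $\varepsilon>0$, and let $s\in C^\infty(\mathbb R)$ be real-valued with $\operatorname{supp}s\subset[-\delta,\infty)$ and $s(t)^2+s(-t)^2=1$ for all $t\in\mathbb R$. Let $\sigma$ be the Lebesgue surface measure on the unit sphere $\mathbb S^d\subset\mathbb R^{d+1}$, and write points of $\mathbb S^d$ as $(\xi\sin\theta,\cos\theta)$ with $\theta\in[0,\pi]$, $\xi\in\mathbb S^{d-1}$. For $g:\mathbb S^d\to\mathbb R$ set $$E(g)(\theta,\xi)=\begin{cases} g(\theta,\xi), & \theta>\pi/2+\delta,\\ s^2(\theta-\tfrac{\pi}{2})\,g(\theta,\xi)+s(\theta-\tfrac{\pi}{2})\,s(\tfrac{\pi}{2}-\theta)\,g(\pi-\theta,\xi), & |\theta-\pi/2|\le\delta,\\ 0, & \theta<\pi/2-\delta,\end{cases}$$ and $E^-=E$, $E^+=\mathrm{Id}-E$. Let $S_\pm(x_1,\dots,x_{d+1})=\big(\tfrac{x_1}{1\pm x_{d+1}},\dots,\tfrac{x_d}{1\pm x_{d+1}}\big)$ be the stereographic projections, $J_d(x)=\big(\tfrac{2}{1+|x|^2}\big)^d$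 for $x\in\mathbb R^d$, and $T_d^\pm(\psi)(u)=\psi(S_\pm(u))/\sqrt{J_d(S_\pm(u))}$ for $\psi:\mathbb R^d\to\mathbb R$. For $N\ge2$ let ${}_N\phi$ be the (continuous, extremal phase) Daubechies scaling function of order $N$, with $\int_{\mathbb R}{}_N\phi=1$ and support $[0,2N-1]$. For a dyadic cube $I=2^{-j}(k+[0,1]^d)$, $j\in\mathbb Z$, $k\in\mathbb Z^d$, let $\psi^{\mathbf 0}_I(x)=2^{jd/2}\prod_{i=1}^d{}_N\phi(2^jx_i-k_i)$, and let $\mathcal D_j$ be the set of those $I$ of side length $2^{-j}$ for which $\operatorname{supp}\psi^{\mathbf 0}_I\subset[-1-\varepsilon,1+\varepsilon]^d$. Let $j_0$ be the smallest integer with $(2N-1)2^{-j_0}\le\varepsilon/2$. For $j\ge j_0$ and $x,y\in\mathbb S^d$ define the stereographic wavelet kernel $$K_j(x,y)=\sum_{I\in\mathcal D_j}\Big[E^+T_d^+(\psi^{\mathbf 0}_I)(x)\,E^+T_d^+(\psi^{\mathbf 0}_I)(y)+E^-T_d^-(\psi^{\mathbf 0}_I)(x)\,E^-T_d^-(\psi^{\mathbf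 0}_I)(y)\Big].$$ Then for every $N\ge 2$ there is a constant $D_N>0$ (which may depend also on the fixed data $d,\delta,s,\varepsilon$, but not on $j$ or $y$) such that for all $y\in\mathbb S^d$ and all integers $j\ge j_0$ the function $x\mapsto K_j(x,y)^2$ is integrable and $$\int_{\mathbb S^d}K_j^2(x,y)\,d\sigma(x)\le D_N\,2^{jd}.$$ -/

import Mathlib

noncomputable section

open MeasureTheory

namespace StereoWavelet

/-! ### The Daubechies scaling function -/

/-- The polynomial `A_N(z) = z^(N-1) P_N((2 - z - z⁻¹)/4)`, where
`P_N(y) = ∑_{k<N} (N-1+k choose k) y^k` is the polynomial of Daubechies. On the unit circle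
`|A_N(e^{-iξ})| = P_N(sin²(ξ/2))`. -/
def spectralPoly (N : ℕ) : Polynomial ℂ :=
  ∑ k ∈ Finset.range N, Polynomial.C ((Nat.choose (N - 1 + k) k : ℕ) : ℂ) *
    (-(Polynomial.C (1 / 4 : ℂ)) * (Polynomial.X - 1) ^ 2) ^ k * Polynomial.X ^ (N - 1 - k)

open Classical in
/-- The roots, with multiplicity, that are kept in the spectral factorization of `A_N`: those
outside the unit circle in the variable `z = e^{-iξ}` (Daubechies' extremal phase choice). -/
def keptRoots (N : ℕ) : Multiset ℂ :=
  (spectralPoly N).roots.filter (fun r => 1 < ‖r‖)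

/-- The Daubechies low-pass symbol
`m₀(ξ) = ((1 + e^{-iξ})/2)^N L(e^{-iξ})`, with `L(z) = ∏ (z - r)/(1 - r)` over the kept roots, so
that `|L(e^{-iξ})|² = P_N(sin²(ξ/2))` and `m₀(0) = 1`. -/
def symbol (N : ℕ) (ξ : ℝ) : ℂ :=
  ((1 + Complex.exp (-(Complex.I * ξ))) / 2) ^ N *
    ((keptRoots N).map (fun r => (Complex.exp (-(Complex.I * ξ)) - r) / (1 - r))).prod

/-- The Fourier transform `∫ φ(x) e^{-ixξ} dx = ∏_{l ≥ 1} m₀(2^{-l} ξ)` of the scaling function. -/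
def scalingHat (N : ℕ) (ξ : ℝ) : ℂ :=
  ∏' l : ℕ, symbol N (ξ / 2 ^ (l + 1))

/-- The Daubechies scaling function `φ` of order `N ≥ 2`, by Fourier inversion; this selects the
continuous representative. The integral is real, since the kept roots are invariant under
conjugation. -/
def scalingFun (N : ℕ) (x : ℝ) : ℝ :=
  ((1 / (2 * Real.pi) : ℂ) * ∫ ξ : ℝ, scalingHat N ξ * Complex.exp (Complex.I * (x * ξ))).re

/-- The dilated and translated tensor product scaling function on `ℝ^d` belonging to the dyadic
cube `I = 2^{-j}(k + [0,1]^d)`: `ψ_I(x) = 2^{jd/2} ∏ᵢ φ(2^j xᵢ - kᵢ)`. -/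
def scaledFun (N d : ℕ) (j : ℤ) (k : Fin d → ℤ) (x : Fin d → ℝ) : ℝ :=
  (2 : ℝ) ^ ((j : ℝ) * (d : ℝ) / 2) * ∏ i, scalingFun N ((2 : ℝ) ^ j * x i - k i)

/-- The (indices `k` of the) dyadic cubes `I` of side `2^{-j}` with
`supp ψ_I ⊆ [-1-ε, 1+ε]^d`. -/
def cubes (N d : ℕ) (ε : ℝ) (j : ℤ) : Set (Fin d → ℤ) :=
  {k | tsupport (scaledFun N d j k) ⊆ Set.Icc (fun _ => -1 - ε) (fun _ => 1 + ε)}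

/-- The smallest integer `j₀` with `(2N-1) 2^{-j₀} ≤ ε/2`. -/
def startLevel (N : ℕ) (ε : ℝ) : ℤ :=
  sInf {j : ℤ | (2 * (N : ℝ) - 1) * (2 : ℝ) ^ (-j) ≤ ε / 2}

/-! ### The sphere -/

/-- The unit sphere `S^d` of `ℝ^{d+1}`. -/
abbrev Sph (d : ℕ) : Type := Metric.sphere (0 : EuclideanSpace ℝ (Fin (d + 1))) 1

/-- The Lebesgue surface measure `σ_d` on `S^d`. -/
def surf (d : ℕ) : Measure (Sph d) :=
  (volume : Measure (EuclideanSpace ℝ (Fin (d + 1)))).toSphere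

/-- The last coordinate `x_{d+1}` of a point of `S^d`. -/
def height {d : ℕ} (u : Sph d) : ℝ := (u : EuclideanSpace ℝ (Fin (d + 1))) (Fin.last d)

/-- The polar angle `θ ∈ [0, π]` of a point `(ξ sin θ, cos θ)` of `S^d`. -/
def angle {d : ℕ} (u : Sph d) : ℝ := Real.arccos (height u)

/-- The reflection `(θ, ξ) ↦ (π - θ, ξ)`, which changes the sign of the last coordinate. -/
def reflect {d : ℕ} (u : Sph d) : Sph d :=
  ⟨WithLp.toLp 2 (fun i => if i = Fin.last d then -(u : EuclideanSpace ℝ (Fin (d + 1))) i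
      else (u : EuclideanSpace ℝ (Fin (d + 1))) i), by
    have h : ‖(u : EuclideanSpace ℝ (Fin (d + 1)))‖ = 1 := mem_sphere_zero_iff_norm.mp u.2
    refine mem_sphere_zero_iff_norm.mpr (Eq.trans ?_ h)
    rw [EuclideanSpace.norm_eq, EuclideanSpace.norm_eq]
    congr 1
    refine Finset.sum_congr rfl fun i _ => ?_
    by_cases hi : i = Fin.last d <;> simp [hi]⟩

/-- The Auscher-Weiss-Wickerhauser operator `E = E_{δ,s}`. -/
def aww {d : ℕ} (δ : ℝ) (s : ℝ → ℝ) (g : Sph d → ℝ) (u : Sph d) : ℝ :=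
  if Real.pi / 2 + δ < angle u then g u
  else if angle u < Real.pi / 2 - δ then 0
  else s (angle u - Real.pi / 2) ^ 2 * g u +
    s (angle u - Real.pi / 2) * s (Real.pi / 2 - angle u) * g (reflect u)

/-- `E⁻ = E`, localized on the lower patch. -/
def awwMinus {d : ℕ} (δ : ℝ) (s : ℝ → ℝ) (g : Sph d → ℝ) (u : Sph d) : ℝ := aww δ s g u

/-- `E⁺ = Id - E`, localized on the upper patch. -/
def awwPlus {d : ℕ} (δ : ℝ) (s : ℝ → ℝ) (g : Sph d → ℝ) (u : Sph d) : ℝ := g u - aww δ s g u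

/-- The stereographic projection `S₋` from the north pole. -/
def stereoMinus {d : ℕ} (u : Sph d) : Fin d → ℝ :=
  fun i => (u : EuclideanSpace ℝ (Fin (d + 1))) i.castSucc / (1 - height u)

/-- The stereographic projection `S₊` from the south pole. -/
def stereoPlus {d : ℕ} (u : Sph d) : Fin d → ℝ :=
  fun i => (u : EuclideanSpace ℝ (Fin (d + 1))) i.castSucc / (1 + height u)

/-- The Jacobian `J_d(x) = (2 / (1 + |x|²))^d` of the inverse stereographic projections. -/
def jac {d : ℕ} (x : Fin d → ℝ) : ℝ := (2 / (1 + ∑ i, x i ^ 2)) ^ d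

/-- The change of variables operator `T_d⁻`. Its value at the north pole, where `S₋` is not
defined, plays no role, since `E⁻` vanishes near the north pole. -/
def transMinus {d : ℕ} (ψ : (Fin d → ℝ) → ℝ) (u : Sph d) : ℝ :=
  ψ (stereoMinus u) / Real.sqrt (jac (stereoMinus u))

/-- The change of variables operator `T_d⁺`. Its value at the south pole, where `S₊` is not
defined, plays no role, since `E⁺` vanishes near the south pole. -/
def transPlus {d : ℕ} (ψ : (Fin d → ℝ) → ℝ) (u : Sph d) : ℝ :=
  ψ (stereoPlus u) / Real.sqrt (jac (stereoPlus u))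

/-- The kernel `K_j(x,y) = ∑_I ∑_± E^± T_d^± ψ_I(x) · E^± T_d^± ψ_I(y)`, the first sum over the
(finitely many) dyadic cubes `I` of side `2^{-j}` with `supp ψ_I ⊆ [-1-ε, 1+ε]^d`. -/
def kernel (N d : ℕ) (δ : ℝ) (s : ℝ → ℝ) (ε : ℝ) (j : ℤ) (x y : Sph d) : ℝ :=
  ∑ᶠ k ∈ cubes N d ε j,
    (awwPlus δ s (transPlus (scaledFun N d j k)) x *
        awwPlus δ s (transPlus (scaledFun N d j k)) y +
      awwMinus δ s (transMinus (scaledFun N d j k)) x *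
        awwMinus δ s (transMinus (scaledFun N d j k)) y)

end StereoWavelet

end

noncomputable section

open MeasureTheory Filter Topology

namespace StereoWavelet

/-! ### Spectral factorization -/

/-! No cancellation or orthogonality is needed: the bound is (size of the kernel)² times (measure of
its support). Fix `y`. A term of the kernel vanishes unless, for `x` as well as for `y`, one of the
two stereographic projections lies in the cube `2^{-j}(k + [0,R]^d)` carrying `ψ_I`
(`kernelTerm_eq_zero`). Boundedly many `k` qualify (`kernel_eq_sum`), each term is `O(2^{jd})`
(`abs_kernelTerm_le`), and the admissible `x` fill a set of measure `O(2^{-jd})`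
(`surf_nearSet_le`). Hence the integral is `O(2^{2jd} · 2^{-jd})`.

This uses only that `φ` is continuous, bounded and compactly supported, which has to be extracted
from its definition as the inverse Fourier transform of an infinite product.

Continuity and boundedness follow from integrability of `φ̂` (`integrable_scalingHat`). Spectral
factorization gives `|L|² = P_N(sin²(ξ/2)) ≤ P_N(1) < 4^(N-1)`, while Viète's product supplies the
decay `|ξ|^{-N}`; together `φ̂ = O(|ξ|^{-r})` with `r > 1`.

Compact support (`scalingFun_eq_zero`) holds because the partial products are Fourier transforms of
finite combinations of point masses in `[0, deg m₀]`, a property that survives the weak limit. The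
interval `[0, deg m₀]` is all that is needed, not the precise `[0, 2N-1]`. -/

/-- Daubechies' polynomial `P_N(y) = ∑_{k<N} (N-1+k choose k) y^k`. -/
def daubechiesPoly (N : ℕ) (y : ℝ) : ℝ :=
  ∑ k ∈ Finset.range N, ((Nat.choose (N - 1 + k) k : ℕ) : ℝ) * y ^ k

lemma daubechiesPoly_zero {N : ℕ} (hN : 2 ≤ N) : daubechiesPoly N 0 = 1 := by
  obtain ⟨n, rfl⟩ : ∃ n, N = n + 1 := ⟨N - 1, by omega⟩
  simp [daubechiesPoly, Finset.sum_range_succ']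

lemma one_le_daubechiesPoly {N : ℕ} (hN : 2 ≤ N) {y : ℝ} (hy : 0 ≤ y) :
    1 ≤ daubechiesPoly N y := by
  rw [← daubechiesPoly_zero hN]
  unfold daubechiesPoly
  gcongr

lemma daubechiesPoly_le_one {N : ℕ} {y : ℝ} (hy : 0 ≤ y) (hy1 : y ≤ 1) :
    daubechiesPoly N y ≤ daubechiesPoly N 1 := by
  unfold daubechiesPoly
  gcongr

/-- The decisive inequality `P_N(1) < 4^(N-1)`, which makes `φ̂` integrable. -/
lemma daubechiesPoly_one_lt {N : ℕ} (hN : 2 ≤ N) : daubechiesPoly N 1 < 4 ^ (N - 1) := by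
  obtain ⟨n, rfl⟩ : ∃ n, N = n + 2 := ⟨N - 2, by omega⟩
  have h1 : ∑ k ∈ Finset.range (n + 2), (n + 1 + k).choose k
      = (2 * (n + 1) + 1).choose (n + 1) := by
    have h := Nat.sum_range_add_choose (n + 1) (n + 1)
    rw [Nat.choose_symm_of_eq_add (show n + 1 + (n + 1) + 1 = (n + 1 + 1) + (n + 1) by ring)] at h
    rw [show 2 * (n + 1) + 1 = n + 1 + (n + 1) + 1 by ring, ← h]
    refine Finset.sum_congr rfl fun k _ => ?_
    rw [add_comm (n + 1) k, Nat.choose_symm_add]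
  -- The lower half of row `2n+3` of Pascal's triangle sums to `4^(n+1)`. By the hockey-stick
  -- identity `P_N(1)` is its last term alone, and the other terms are positive: hence the strict
  -- inequality.
  have h2 := Nat.sum_range_choose_halfway (n + 1)
  rw [Finset.sum_range_succ, ← h1] at h2
  have h3 : 1 ≤ ∑ i ∈ Finset.range (n + 1), (2 * (n + 1) + 1).choose i := by
    rw [Finset.sum_range_succ']
    simp
  have h4 : ∑ k ∈ Finset.range (n + 2), (n + 1 + k).choose k < 4 ^ (n + 1) := by omega
  have h5 : daubechiesPoly (n + 2) 1
      = ((∑ k ∈ Finset.range (n + 2), (n + 1 + k).choose k : ℕ) : ℝ) := by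
    simp [daubechiesPoly]
  rw [h5]
  exact_mod_cast h4

/-- Truncating the binomial series of `(1-y)^{-N}`. -/
lemma pow_mul_daubechiesPoly_le {N : ℕ} (hN : 2 ≤ N) {y : ℝ} (hy : 0 ≤ y) (hy1 : y ≤ 1) :
    (1 - y) ^ N * daubechiesPoly N y ≤ 1 := by
  rcases eq_or_lt_of_le hy1 with rfl | hlt
  · simp [show N ≠ 0 by omega]
  · have hs := hasSum_choose_mul_geometric_of_norm_lt_one (N - 1) (r := y)
      (by rwa [Real.norm_of_nonneg hy])
    have h := sum_le_hasSum (Finset.range N) (fun i _ => by positivity) hs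
    rw [show N - 1 + 1 = N by omega, le_div_iff₀ (by apply pow_pos; linarith)] at h
    refine le_trans (le_of_eq ?_) h
    rw [mul_comm, daubechiesPoly]
    congr 1
    refine Finset.sum_congr rfl fun k _ => ?_
    rw [add_comm (N - 1) k, Nat.choose_symm_add]

lemma spectralPoly_eval (N : ℕ) (z : ℂ) :
    (spectralPoly N).eval z = ∑ k ∈ Finset.range N, ((Nat.choose (N - 1 + k) k : ℕ) : ℂ) *
      (-(1 / 4) * (z - 1) ^ 2) ^ k * z ^ (N - 1 - k) := by
  simp [spectralPoly, Polynomial.eval_finsetSum]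

/-- On the circle `z⁻¹` is the conjugate of `z`, so `(2 - z - z⁻¹)/4 = |z - 1|²/4`, which is
`sin²(ξ/2)` for `z = e^{-iξ}`. -/
lemma sq_sub_one_of_norm_one {z : ℂ} (hz : ‖z‖ = 1) :
    -(1 / 4) * (z - 1) ^ 2 = z * ((‖z - 1‖ ^ 2 / 4 : ℝ) : ℂ) := by
  have h : z * (starRingEnd ℂ) z = 1 := by
    rw [Complex.mul_conj, Complex.normSq_eq_norm_sq, hz]; simp
  have h2 : ((‖z - 1‖ ^ 2 : ℝ) : ℂ) = (z - 1) * ((starRingEnd ℂ) z - 1) := by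
    rw [← Complex.normSq_eq_norm_sq, ← Complex.mul_conj]; simp
  push_cast at h2 ⊢
  rw [h2]
  linear_combination (-(1 / 4) * (z - 1)) * h

lemma norm_spectralPoly_eval {N : ℕ} {z : ℂ} (hz : ‖z‖ = 1) :
    ‖(spectralPoly N).eval z‖ = daubechiesPoly N (‖z - 1‖ ^ 2 / 4) := by
  have h : (spectralPoly N).eval z
      = z ^ (N - 1) * (daubechiesPoly N (‖z - 1‖ ^ 2 / 4) : ℂ) := by
    rw [spectralPoly_eval, sq_sub_one_of_norm_one hz, daubechiesPoly, Complex.ofReal_sum,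
      Finset.mul_sum]
    refine Finset.sum_congr rfl fun k hk => ?_
    rw [Finset.mem_range] at hk
    rw [mul_pow, show N - 1 = k + (N - 1 - k) by omega, pow_add, show k + (N - 1 - k) = N - 1 by omega]
    push_cast
    ring
  rw [h, norm_mul, norm_pow, hz, one_pow, one_mul, Complex.norm_real, Real.norm_of_nonneg]
  unfold daubechiesPoly
  positivity

/-- `A_N` is self-reciprocal with formal degree `2(N-1)`, because `(z⁻¹ - 1)² = (z - 1)² z⁻²`. This
is the source of the symmetry of its roots. -/
lemma spectralPoly_eval_eq_conj (N : ℕ) {z : ℂ} (hz : z ≠ 0) :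
    (spectralPoly N).eval z
      = z ^ (2 * (N - 1)) *
        (starRingEnd ℂ) ((spectralPoly N).eval ((starRingEnd ℂ) z)⁻¹) := by
  rw [spectralPoly_eval, spectralPoly_eval, map_sum, Finset.mul_sum]
  refine Finset.sum_congr rfl fun k hk => ?_
  rw [Finset.mem_range] at hk
  obtain ⟨m, hm⟩ : ∃ m, N - 1 = k + m := ⟨N - 1 - k, by omega⟩
  rw [show N - 1 - k = m by omega, hm]
  simp only [map_mul, map_pow, map_sub, map_neg, map_div₀, map_one, map_inv₀, map_natCast,
    Complex.conj_conj, map_ofNat]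
  have h1 : (z⁻¹ - 1) ^ 2 = (z - 1) ^ 2 * (z⁻¹) ^ 2 := by field_simp; ring
  have h2 : z ^ (2 * (k + m)) * ((z⁻¹ ^ 2) ^ k * z⁻¹ ^ m) = z ^ m := by
    rw [show 2 * (k + m) = 2 * k + m + m by ring, pow_add, pow_add, pow_mul, inv_pow, inv_pow,
      inv_pow]
    field_simp
  rw [h1, ← mul_assoc (-(1 / 4 : ℂ)), mul_pow _ ((z⁻¹) ^ 2) k]
  linear_combination (-((Nat.choose (k + m + k) k : ℕ) : ℂ) *
      (-(1 / 4) * (z - 1) ^ 2) ^ k) * h2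

lemma spectralPoly_eval_zero_ne {N : ℕ} (hN : 2 ≤ N) : (spectralPoly N).eval 0 ≠ 0 := by
  obtain ⟨n, rfl⟩ : ∃ n, N = n + 1 := ⟨N - 1, by omega⟩
  rw [spectralPoly_eval, Finset.sum_eq_single n]
  · simp only [Nat.add_sub_cancel, Nat.sub_self, pow_zero, mul_one]
    refine mul_ne_zero ?_ (pow_ne_zero _ (by norm_num))
    exact_mod_cast (Nat.choose_pos (Nat.le_add_left n n)).ne'
  · intro k hk hkn
    rw [Finset.mem_range] at hk
    rw [zero_pow (by omega), mul_zero]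
  · simp

lemma spectralPoly_eval_ne {N : ℕ} (hN : 2 ≤ N) {z : ℂ} (hz : ‖z‖ = 1) :
    (spectralPoly N).eval z ≠ 0 := by
  rw [← norm_pos_iff, norm_spectralPoly_eval hz]
  linarith [one_le_daubechiesPoly hN (show 0 ≤ ‖z - 1‖ ^ 2 / 4 by positivity)]

lemma spectralPoly_ne_zero {N : ℕ} (hN : 2 ≤ N) : spectralPoly N ≠ 0 := by
  intro h
  exact spectralPoly_eval_zero_ne hN (by rw [h]; simp)

lemma eval_eq_prod_roots (p : Polynomial ℂ) (z : ℂ) :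
    p.eval z = p.leadingCoeff * (p.roots.map fun r => z - r).prod := by
  conv_lhs => rw [(IsAlgClosed.splits p).eq_prod_roots]
  simp [Polynomial.eval_multiset_prod, Multiset.map_map]

/-- Reflection in the unit circle. -/
def circleInv (r : ℂ) : ℂ := ((starRingEnd ℂ) r)⁻¹

lemma norm_circleInv (r : ℂ) : ‖circleInv r‖ = ‖r‖⁻¹ := by simp [circleInv]

/-- Self-reciprocity writes `A_N` off the origin as a constant times `z^(m-n) ∏ (z - circleInv r)`.
Two polynomials agreeing at infinitely many points coincide, so their roots agree with multiplicity.
-/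
lemma spectralPoly_roots_circleInv {N : ℕ} (hN : 2 ≤ N) :
    (spectralPoly N).roots.map circleInv = (spectralPoly N).roots := by
  set A := spectralPoly N with hA
  have hA0 : A ≠ 0 := spectralPoly_ne_zero hN
  have hr0 : ∀ r ∈ A.roots, r ≠ 0 := by
    rintro r hr rfl
    exact spectralPoly_eval_zero_ne hN (Polynomial.isRoot_of_mem_roots hr)
  have hcard : Multiset.card A.roots = A.natDegree :=
    (IsAlgClosed.splits A).natDegree_eq_card_roots.symm
  set n := Multiset.card A.roots with hn
  set m := 2 * (N - 1) with hm
  have hdeg : n ≤ m := by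
    rw [hcard, hA, spectralPoly]
    refine Polynomial.natDegree_sum_le_of_forall_le _ _ fun k hk => ?_
    rw [Finset.mem_range] at hk
    have : Polynomial.natDegree (Polynomial.C ((Nat.choose (N - 1 + k) k : ℕ) : ℂ) *
        (-(Polynomial.C (1 / 4 : ℂ)) * (Polynomial.X - 1) ^ 2) ^ k *
          Polynomial.X ^ (N - 1 - k)) ≤ 0 + k * (0 + 2 * 1) + (N - 1 - k) := by
      refine Polynomial.natDegree_mul_le_of_le (Polynomial.natDegree_mul_le_of_le ?_ ?_) ?_
      · simp
      · refine Polynomial.natDegree_pow_le_of_le _ (Polynomial.natDegree_mul_le_of_le ?_ ?_)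
        · rw [← Polynomial.C_neg]; simp
        · refine Polynomial.natDegree_pow_le_of_le _ ?_
          rw [← Polynomial.C_1]
          exact Polynomial.natDegree_X_sub_C_le _
      · simp
    omega
  set c : ℂ := (starRingEnd ℂ) A.leadingCoeff *
    (A.roots.map fun r => -(starRingEnd ℂ) r).prod with hc
  have key : ∀ z : ℂ, z ≠ 0 → A.eval z
      = c * (z ^ (m - n) * (A.roots.map fun r => z - circleInv r).prod) := by
    intro z hz
    rw [hA, spectralPoly_eval_eq_conj N hz, ← hA, eval_eq_prod_roots, map_mul,
      map_multiset_prod, Multiset.map_map, hc]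
    have h1 : (A.roots.map fun r => -(starRingEnd ℂ) r).prod *
        (A.roots.map fun r => z - circleInv r).prod
        = z ^ n * (A.roots.map
          (⇑(starRingEnd ℂ) ∘ fun r => ((starRingEnd ℂ) z)⁻¹ - r)).prod := by
      rw [← Multiset.prod_map_mul, hn, ← Multiset.prod_replicate, ← Multiset.map_const',
        ← Multiset.prod_map_mul]
      refine congrArg _ (Multiset.map_congr rfl fun r hr => ?_)
      have : (starRingEnd ℂ) r ≠ 0 := by simpa using hr0 r hr
      simp only [Function.comp, map_sub, map_inv₀, Complex.conj_conj, circleInv]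
      field_simp
      ring
    have h2 : z ^ (2 * (N - 1)) = z ^ (m - n) * z ^ n := by
      rw [← pow_add]; congr 1; omega
    rw [h2]
    linear_combination (-(starRingEnd ℂ) A.leadingCoeff * z ^ (m - n)) * h1
  set S : Multiset ℂ := A.roots.map circleInv + Multiset.replicate (m - n) 0 with hS
  have hpoly : A = Polynomial.C c * (S.map fun r => Polynomial.X - Polynomial.C r).prod := by
    refine Polynomial.eq_of_infinite_eval_eq _ _ (Set.Infinite.mono (s := {0}ᶜ) ?_
      (Set.finite_singleton (0 : ℂ)).infinite_compl)
    intro z hz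
    rw [Set.mem_ofPred_eq, key z hz]
    simp [hS, Polynomial.eval_multiset_prod, Multiset.map_map]
    exact Or.inl (mul_comm _ _)
  have hc0 : c ≠ 0 := by
    intro h
    rw [h] at hpoly
    exact hA0 (by simpa using hpoly)
  have hroots : A.roots = S := by
    conv_lhs => rw [hpoly]
    rw [Polynomial.roots_C_mul _ hc0, Polynomial.roots_multiset_prod_X_sub_C]
  -- The power `z^(m-n)` allowed for a degree below `2(N-1)`; counting roots on both sides excludes
  -- it.
  have hmn : m - n = 0 := by
    have := congrArg Multiset.card hroots
    simp only [hS, Multiset.card_add, Multiset.card_map, Multiset.card_replicate] at this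
    omega
  rw [hmn] at hS
  rw [hS] at hroots
  simpa using hroots.symm

lemma norm_multiset_prod (s : Multiset ℂ) : ‖s.prod‖ = (s.map norm).prod :=
  map_multiset_prod (normHom : ℂ →*₀ ℝ) s

/-- No root lies on the circle, so the roots come in pairs `r`, `circleInv r` with `r` outside. On
the circle the two distances are proportional: `|z - circleInv r| = |z - r| / |r|`. -/
lemma norm_spectralPoly_eval_keptRoots {N : ℕ} (hN : 2 ≤ N) {z : ℂ} (hz : ‖z‖ = 1) :
    ‖(spectralPoly N).eval z‖ = ‖(spectralPoly N).leadingCoeff‖ *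
      ((keptRoots N).map fun r => ‖z - r‖ ^ 2 / ‖r‖).prod := by
  classical
  have hsplit : (spectralPoly N).roots = keptRoots N + (keptRoots N).map circleInv := by
    have h1 : (spectralPoly N).roots.filter (fun r => ¬ 1 < ‖r‖)
        = (keptRoots N).map circleInv := by
      conv_lhs => rw [← spectralPoly_roots_circleInv hN]
      rw [Multiset.filter_map, keptRoots]
      congr 1
      refine Multiset.filter_congr fun r hr => ?_
      have hr1 : ‖r‖ ≠ 1 := fun h =>
        spectralPoly_eval_ne hN h (Polynomial.isRoot_of_mem_roots hr)
      have hr0 : 0 < ‖r‖ := by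
        rw [norm_pos_iff]
        rintro rfl
        exact spectralPoly_eval_zero_ne hN (Polynomial.isRoot_of_mem_roots hr)
      rw [Function.comp, norm_circleInv, not_lt, inv_le_one₀ hr0]
      exact ⟨fun h => lt_of_le_of_ne h hr1.symm, le_of_lt⟩
    rw [← h1, keptRoots]
    convert! (Multiset.filter_add_not (fun r : ℂ => 1 < ‖r‖) _).symm
  rw [eval_eq_prod_roots, norm_mul, norm_multiset_prod, hsplit]
  simp only [Multiset.map_add, Multiset.prod_add, Multiset.map_map]
  rw [← Multiset.prod_map_mul]
  congr 2
  refine Multiset.map_congr rfl fun r hr => ?_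
  have hr1 : 1 < ‖r‖ := (Multiset.mem_filter.mp hr).2
  have hr0 : (starRingEnd ℂ) r ≠ 0 := by
    rw [Ne, map_eq_zero, ← norm_eq_zero]; linarith
  have h1 : z * (starRingEnd ℂ) z = 1 := by
    rw [Complex.mul_conj, Complex.normSq_eq_norm_sq, hz]; simp
  have h2 : z - circleInv r = -z * (starRingEnd ℂ) (z - r) / (starRingEnd ℂ) r := by
    rw [circleInv, map_sub]
    field_simp
    linear_combination h1
  simp only [Function.comp]
  rw [h2, norm_div, norm_mul, norm_neg, hz, one_mul, RCLike.norm_conj, RCLike.norm_conj]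
  ring

lemma keptRoots_ne_one {N : ℕ} {r : ℂ} (hr : r ∈ keptRoots N) : 1 - r ≠ 0 := by
  have h : 1 < ‖r‖ := (Multiset.mem_filter.mp hr).2
  intro h0
  rw [← sub_eq_zero.mp h0] at h
  simp at h

/-- The factor `L(z) = ∏ (z - r)/(1 - r)` of the symbol. -/
def symbolFactor (N : ℕ) (z : ℂ) : ℂ := ((keptRoots N).map fun r => (z - r) / (1 - r)).prod

/-- Both sides are multiples of the same product over the kept roots; the factor is fixed at `z =
1`, where `P_N(0) = 1` and `L(1) = 1`. -/
lemma norm_sq_symbolFactor {N : ℕ} (hN : 2 ≤ N) {z : ℂ} (hz : ‖z‖ = 1) :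
    ‖symbolFactor N z‖ ^ 2 = daubechiesPoly N (‖z - 1‖ ^ 2 / 4) := by
  have h1 := norm_spectralPoly_eval_keptRoots hN (z := 1) (by simp)
  rw [norm_spectralPoly_eval (by simp)] at h1
  simp only [sub_self, norm_zero, ne_eq, OfNat.ofNat_ne_zero, not_false_eq_true, zero_pow,
    zero_div, daubechiesPoly_zero hN] at h1
  rw [← norm_spectralPoly_eval hz, norm_spectralPoly_eval_keptRoots hN hz, symbolFactor,
    norm_multiset_prod, Multiset.map_map, ← Multiset.prod_map_pow]
  have h2 : ((keptRoots N).map fun r => ‖z - r‖ ^ 2 / ‖r‖).prod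
      = ((keptRoots N).map fun r => ‖1 - r‖ ^ 2 / ‖r‖).prod *
        ((keptRoots N).map fun r => (norm ∘ fun r => (z - r) / (1 - r)) r ^ 2).prod := by
    rw [← Multiset.prod_map_mul]
    refine congrArg _ (Multiset.map_congr rfl fun r hr => ?_)
    have := norm_ne_zero_iff.mpr (keptRoots_ne_one hr)
    simp only [Function.comp, norm_div]
    field_simp
  rw [h2, ← mul_assoc, ← h1, one_mul]

/-- The symbol as a polynomial in `z = e^{-iξ}`. -/
def symbolPoly (N : ℕ) : Polynomial ℂ :=
  (Polynomial.C (1 / 2) * (1 + Polynomial.X)) ^ N *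
    ((keptRoots N).map fun r => Polynomial.C (1 / (1 - r)) * (Polynomial.X - Polynomial.C r)).prod

lemma symbolPoly_eval (N : ℕ) (z : ℂ) :
    (symbolPoly N).eval z = ((1 + z) / 2) ^ N * symbolFactor N z := by
  simp only [symbolPoly, symbolFactor, Polynomial.eval_mul, Polynomial.eval_pow,
    Polynomial.eval_C, Polynomial.eval_add, Polynomial.eval_one, Polynomial.eval_X,
    Polynomial.eval_multiset_prod, Multiset.map_map, Function.comp_def, Polynomial.eval_sub]
  congr 2
  · ring
  · exact Multiset.map_congr rfl fun r _ => by ring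

lemma symbol_eq_eval (N : ℕ) (ξ : ℝ) :
    symbol N ξ = (symbolPoly N).eval (Complex.exp (-(Complex.I * ξ))) := by
  rw [symbolPoly_eval]; rfl

lemma symbolPoly_eval_one (N : ℕ) : (symbolPoly N).eval 1 = 1 := by
  rw [symbolPoly_eval, symbolFactor]
  have : (keptRoots N).map (fun r => (1 - r) / (1 - r)) = (keptRoots N).map fun _ => (1 : ℂ) :=
    Multiset.map_congr rfl fun r hr => div_self (keptRoots_ne_one hr)
  rw [this]
  norm_num

/-- With `y = |z - 1|²/4` the parallelogram law gives `|(1 + z)/2|² = 1 - y`, so `|m₀|² = (1 - y)^N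
P_N(y) ≤ 1`. -/
lemma norm_symbolPoly_eval_le_one {N : ℕ} (hN : 2 ≤ N) {z : ℂ} (hz : ‖z‖ = 1) :
    ‖(symbolPoly N).eval z‖ ≤ 1 := by
  have hpar := parallelogram_law_with_norm ℝ z 1
  rw [hz, norm_one] at hpar
  have h1 : (‖1 + z‖ / 2) ^ 2 = 1 - ‖z - 1‖ ^ 2 / 4 := by
    rw [add_comm 1 z]; linarith
  have h2 : ‖(symbolPoly N).eval z‖ ^ 2
      = (1 - ‖z - 1‖ ^ 2 / 4) ^ N * daubechiesPoly N (‖z - 1‖ ^ 2 / 4) := by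
    rw [symbolPoly_eval, norm_mul, mul_pow, norm_sq_symbolFactor hN hz, norm_pow, norm_div,
      ← h1, ← pow_mul, ← pow_mul, mul_comm N 2]
    simp
  have h3 := pow_mul_daubechiesPoly_le hN (y := ‖z - 1‖ ^ 2 / 4) (by positivity)
    (by nlinarith [sq_nonneg (‖1 + z‖ / 2)])
  rw [← h2] at h3
  exact (sq_le_one_iff₀ (norm_nonneg _)).mp h3

lemma norm_symbolFactor_le {N : ℕ} (hN : 2 ≤ N) {z : ℂ} (hz : ‖z‖ = 1) :
    ‖symbolFactor N z‖ ≤ Real.sqrt (daubechiesPoly N 1) := by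
  refine Real.le_sqrt_of_sq_le ?_
  rw [norm_sq_symbolFactor hN hz]
  refine daubechiesPoly_le_one (by positivity) ?_
  have : ‖z - 1‖ ≤ 2 := by
    refine (norm_sub_le _ _).trans ?_
    rw [hz, norm_one]; norm_num
  nlinarith [norm_nonneg (z - 1)]

/-! ### The Fourier transform of the scaling function -/

lemma norm_exp_neg_I_mul (ξ : ℝ) : ‖Complex.exp (-(Complex.I * ξ))‖ = 1 := by
  have := Complex.norm_exp_I_mul_ofReal (-ξ)
  rwa [Complex.ofReal_neg, mul_neg] at this

/-- Since `m₀(0) = 1`, `X - 1` divides `symbolPoly N - 1`, and the cofactor is bounded on the disc.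
Along `ξ / 2^l` this makes the infinite product converge absolutely. -/
lemma norm_symbol_sub_one_le (N : ℕ) : ∃ C : ℝ, ∀ ξ : ℝ, ‖symbol N ξ - 1‖ ≤ C * |ξ| := by
  obtain ⟨R, hR⟩ : (Polynomial.X - Polynomial.C 1) ∣ (symbolPoly N - 1) := by
    rw [Polynomial.dvd_iff_isRoot]
    simp [symbolPoly_eval_one]
  obtain ⟨C, hC⟩ := (isCompact_closedBall (0 : ℂ) 1).exists_bound_of_continuousOn
    (f := fun z => R.eval z) (Polynomial.continuous R).continuousOn
  refine ⟨C, fun ξ => ?_⟩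
  set z := Complex.exp (-(Complex.I * ξ)) with hz
  have h1 : symbol N ξ - 1 = (z - 1) * R.eval z := by
    have := congrArg (Polynomial.eval z) hR
    simpa [symbol_eq_eval, ← hz] using this
  have h2 : ‖z - 1‖ ≤ |ξ| := by
    have := Real.norm_exp_I_mul_ofReal_sub_one_le (x := -ξ)
    rwa [Complex.ofReal_neg, mul_neg, norm_neg, Real.norm_eq_abs, ← hz] at this
  have h3 : ‖R.eval z‖ ≤ C := hC z (by simp [hz, norm_exp_neg_I_mul])
  rw [h1, norm_mul, mul_comm]
  exact mul_le_mul h3 h2 (norm_nonneg _) ((norm_nonneg _).trans h3)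

/-- The partial products of `φ̂`. -/
def scalingHatPartial (N n : ℕ) (ξ : ℝ) : ℂ := ∏ l ∈ Finset.range n, symbol N (ξ / 2 ^ (l + 1))

lemma tendsto_scalingHatPartial (N : ℕ) (ξ : ℝ) :
    Tendsto (fun n => scalingHatPartial N n ξ) atTop (𝓝 (scalingHat N ξ)) := by
  obtain ⟨C, hC⟩ := norm_symbol_sub_one_le N
  have hs : Summable fun l : ℕ => ‖symbol N (ξ / 2 ^ (l + 1)) - 1‖ := by
    refine Summable.of_nonneg_of_le (fun _ => norm_nonneg _) (fun l => hC _) ?_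
    have : (fun l : ℕ => C * |ξ / 2 ^ (l + 1)|) = fun l : ℕ => C * |ξ| / 2 * (1 / 2) ^ l := by
      funext l
      rw [abs_div, abs_of_pos (show (0 : ℝ) < 2 ^ (l + 1) by positivity), pow_succ, one_div,
        inv_pow]
      field_simp
    rw [this]
    exact summable_geometric_two.mul_left _
  have hm := multipliable_one_add_of_summable hs
  simp only [add_sub_cancel] at hm
  exact hm.hasProd.tendsto_prod_nat

lemma norm_symbol_le_one {N : ℕ} (hN : 2 ≤ N) (ξ : ℝ) : ‖symbol N ξ‖ ≤ 1 := by
  rw [symbol_eq_eval]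
  exact norm_symbolPoly_eval_le_one hN (norm_exp_neg_I_mul ξ)

lemma norm_scalingHatPartial_le_one {N : ℕ} (hN : 2 ≤ N) (n : ℕ) (ξ : ℝ) :
    ‖scalingHatPartial N n ξ‖ ≤ 1 := by
  rw [scalingHatPartial, norm_prod]
  exact Finset.prod_le_one (fun _ _ => norm_nonneg _) fun _ _ => norm_symbol_le_one hN _

lemma norm_scalingHat_le_partial {N : ℕ} (hN : 2 ≤ N) (n : ℕ) (ξ : ℝ) :
    ‖scalingHat N ξ‖ ≤ ‖scalingHatPartial N n ξ‖ := by
  refine le_of_tendsto (tendsto_scalingHatPartial N ξ).norm ?_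
  filter_upwards [eventually_ge_atTop n] with m hm
  rw [scalingHatPartial, scalingHatPartial, ← Finset.prod_range_mul_prod_Ico _ hm, norm_mul]
  refine mul_le_of_le_one_right (norm_nonneg _) ?_
  rw [norm_prod]
  exact Finset.prod_le_one (fun _ _ => norm_nonneg _) fun _ _ => norm_symbol_le_one hN _

/-- Viète's product, in absolute values. -/
lemma prod_norm_one_add_exp (n : ℕ) (ξ : ℝ) :
    (∏ l ∈ Finset.range n, ‖(1 + Complex.exp (-(Complex.I * (ξ / 2 ^ (l + 1) : ℝ)))) / 2‖) *
      (2 ^ n * ‖1 - Complex.exp (-(Complex.I * (ξ / 2 ^ n : ℝ)))‖)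
      = ‖1 - Complex.exp (-(Complex.I * ξ))‖ := by
  induction n with
  | zero => simp
  | succ n ih =>
    rw [← ih, Finset.prod_range_succ]
    set w := Complex.exp (-(Complex.I * (ξ / 2 ^ (n + 1) : ℝ))) with hw
    have h1 : Complex.exp (-(Complex.I * (ξ / 2 ^ n : ℝ))) = w ^ 2 := by
      rw [hw, ← Complex.exp_nat_mul]
      congr 1
      push_cast
      field_simp
      ring
    rw [h1, show (1 : ℂ) - w ^ 2 = (1 + w) / 2 * (2 * (1 - w)) by ring, norm_mul ((1 + w) / 2),
      norm_mul 2, Complex.norm_ofNat]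
    ring

lemma half_le_norm_one_sub_exp {η : ℝ} (h1 : 1 ≤ |η|) (h2 : |η| ≤ 2) :
    1 / 2 ≤ ‖1 - Complex.exp (-(Complex.I * η))‖ := by
  have h := Complex.norm_exp_I_mul_ofReal_sub_one (-η)
  rw [Complex.ofReal_neg, mul_neg] at h
  rw [norm_sub_rev, h, norm_mul, neg_div, Real.sin_neg, norm_neg, Real.norm_eq_abs,
    Real.norm_eq_abs, abs_two]
  have h5 : |Real.sin (η / 2)| = |Real.sin (|η| / 2)| := by
    rcases abs_cases η with ⟨h, -⟩ | ⟨h, -⟩ <;> rw [h]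
    rw [neg_div, Real.sin_neg, abs_neg]
  rw [h5]
  have h3 := Real.mul_le_sin (x := |η| / 2) (by positivity)
    (by linarith [Real.pi_gt_three])
  -- Jordan's inequality yields `sin(|η|/2) ≥ |η|/π ≥ 1/4`, and the chord is twice the sine.
  have h4 : (1 : ℝ) / 4 ≤ 2 / Real.pi * (|η| / 2) := by
    have := Real.pi_le_four
    rw [div_mul_div_comm, div_le_div_iff₀ (by norm_num) (by positivity)]
    nlinarith
  linarith [le_abs_self (Real.sin (|η| / 2))]

/-- The decay rate `√P_N(1) / 2^N` of `φ̂` per octave. -/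
def decayRate (N : ℕ) : ℝ := Real.sqrt (daubechiesPoly N 1) / 2 ^ N

lemma decayRate_pos {N : ℕ} (hN : 2 ≤ N) : 0 < decayRate N := by
  have := one_le_daubechiesPoly hN zero_le_one
  unfold decayRate
  positivity

lemma decayRate_lt {N : ℕ} (hN : 2 ≤ N) : decayRate N < 1 / 2 := by
  have h1 : Real.sqrt (daubechiesPoly N 1) < 2 ^ (N - 1) := by
    rw [Real.sqrt_lt' (by positivity), ← pow_mul, mul_comm, pow_mul]
    norm_num
    exact daubechiesPoly_one_lt hN
  rw [decayRate, div_lt_iff₀ (by positivity)]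
  refine h1.trans_le (le_of_eq ?_)
  obtain ⟨n, rfl⟩ : ∃ n, N = n + 1 := ⟨N - 1, by omega⟩
  rw [Nat.add_sub_cancel, pow_succ]
  ring

/-- Only the first `n` factors are used. Since `|ξ / 2^n|` is in `[1, 2]`, Viète's product is at
most `2 / (2^n · 1/2) = 4 / 2^n`; its `N`-th power meets `n` factors `|L| ≤ √P_N(1)`. -/
lemma norm_scalingHat_le_octave {N : ℕ} (hN : 2 ≤ N) (n : ℕ) {ξ : ℝ} (h1 : 2 ^ n ≤ |ξ|)
    (h2 : |ξ| ≤ 2 ^ (n + 1)) : ‖scalingHat N ξ‖ ≤ 4 ^ N * decayRate N ^ n := by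
  refine (norm_scalingHat_le_partial hN n ξ).trans ?_
  set p : ℝ := ∏ l ∈ Finset.range n,
    ‖(1 + Complex.exp (-(Complex.I * (ξ / 2 ^ (l + 1) : ℝ)))) / 2‖ with hp
  have hp0 : 0 ≤ p := Finset.prod_nonneg fun _ _ => norm_nonneg _
  have hp1 : p ≤ 4 / 2 ^ n := by
    have hv := prod_norm_one_add_exp n ξ
    have habs : |ξ / 2 ^ n| = |ξ| / 2 ^ n := by
      rw [abs_div, abs_of_pos (show (0 : ℝ) < 2 ^ n by positivity)]
    have hl : (1 : ℝ) / 2 ≤ ‖1 - Complex.exp (-(Complex.I * (ξ / 2 ^ n : ℝ)))‖ := by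
      apply half_le_norm_one_sub_exp
      · rw [habs, le_div_iff₀ (by positivity)]; linarith
      · rw [habs, div_le_iff₀ (by positivity)]; rw [pow_succ] at h2; linarith
    have hu : ‖1 - Complex.exp (-(Complex.I * ξ))‖ ≤ 2 := by
      refine (norm_sub_le _ _).trans ?_
      rw [norm_exp_neg_I_mul, norm_one]; norm_num
    rw [← hp] at hv
    rw [le_div_iff₀ (by positivity)]
    have : p * 2 ^ n * (1 / 2) ≤ p * 2 ^ n *
        ‖1 - Complex.exp (-(Complex.I * (ξ / 2 ^ n : ℝ)))‖ := by gcongr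
    nlinarith
  have hprod : ‖scalingHatPartial N n ξ‖
      ≤ p ^ N * Real.sqrt (daubechiesPoly N 1) ^ n := by
    rw [scalingHatPartial, norm_prod, hp, ← Finset.prod_pow,
      ← Finset.card_range n, ← Finset.prod_const, Finset.card_range, ← Finset.prod_mul_distrib]
    refine Finset.prod_le_prod (fun _ _ => norm_nonneg _) fun l _ => ?_
    rw [symbol_eq_eval, symbolPoly_eval, norm_mul, norm_pow]
    gcongr
    exact norm_symbolFactor_le hN (norm_exp_neg_I_mul _)
  refine hprod.trans ?_
  calc p ^ N * Real.sqrt (daubechiesPoly N 1) ^ n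
      ≤ (4 / 2 ^ n) ^ N * Real.sqrt (daubechiesPoly N 1) ^ n := by gcongr
    _ = 4 ^ N * decayRate N ^ n := by
        rw [decayRate, div_pow, div_pow, ← pow_mul, ← pow_mul, mul_comm n N]
        ring

lemma measurable_scalingHat (N : ℕ) : Measurable (scalingHat N) := by
  refine measurable_of_tendsto_metrizable (f := fun n => scalingHatPartial N n) (fun n => ?_)
    (tendsto_pi_nhds.mpr fun ξ => tendsto_scalingHatPartial N ξ)
  refine Continuous.measurable ?_
  unfold scalingHatPartial
  refine continuous_finsetProd _ fun l _ => ?_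
  simp only [symbol_eq_eval]
  exact (Polynomial.continuous _).comp (by fun_prop)

lemma integrable_scalingHat {N : ℕ} (hN : 2 ≤ N) : Integrable (scalingHat N) := by
  set ρ := decayRate N with hρ
  have hρ0 : 0 < ρ := decayRate_pos hN
  -- Chosen so that `2^(-r) = ρ`; then `ρ < 1/2` means `r > 1`, the threshold for integrability on
  -- the line.
  set r : ℝ := -Real.logb 2 ρ with hr
  have h2r : ∀ m : ℕ, ((2 : ℝ) ^ m) ^ (-r) = ρ ^ m := by
    intro m
    rw [← Real.rpow_natCast, ← Real.rpow_mul (by norm_num), mul_comm, Real.rpow_mul (by norm_num),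
      hr, neg_neg, Real.rpow_logb (by norm_num) (by norm_num) hρ0, Real.rpow_natCast]
  have hr1 : 1 < r := by
    have : Real.logb 2 ρ < -1 := by
      rw [Real.logb_lt_iff_lt_rpow (by norm_num) hρ0, Real.rpow_neg (by norm_num), Real.rpow_one]
      simpa using decayRate_lt hN
    rw [hr]; linarith
  have hint : Integrable fun ξ : ℝ => (1 + ‖ξ‖) ^ (-r) :=
    integrable_one_add_norm (by simpa using hr1)
  -- The factor `ρ⁻²` pays for replacing `ρ^n` by `ρ^(n+2)`, as `1 + |ξ| ≤ 2^(n+2)` on the `n`-th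
  -- octave.
  refine (hint.const_mul (4 ^ N * ρ⁻¹ ^ 2)).mono'
    (measurable_scalingHat N).aestronglyMeasurable (Eventually.of_forall fun ξ => ?_)
  have key : ∀ m : ℕ, 1 + ‖ξ‖ ≤ 2 ^ m → ρ ^ m ≤ (1 + ‖ξ‖) ^ (-r) := by
    intro m hm
    rw [← h2r]
    exact Real.rpow_le_rpow_of_nonpos (by positivity) hm (by linarith)
  rcases lt_or_ge |ξ| 1 with h | h
  · have h1 := key 2 (by rw [Real.norm_eq_abs]; linarith)
    have h2 := norm_scalingHat_le_partial hN 0 ξ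
    rw [scalingHatPartial, Finset.range_zero, Finset.prod_empty, norm_one] at h2
    refine h2.trans ?_
    calc (1 : ℝ) ≤ 4 ^ N := one_le_pow₀ (by norm_num)
      _ = 4 ^ N * ρ⁻¹ ^ 2 * ρ ^ 2 := by field_simp
      _ ≤ _ := by gcongr
  · obtain ⟨n, hn1, hn2⟩ := exists_nat_pow_near h (show (1 : ℝ) < 2 by norm_num)
    have h1 := key (n + 2) (by
      rw [Real.norm_eq_abs]
      have : (2 : ℝ) ^ (n + 2) = 2 ^ (n + 1) + 2 ^ (n + 1) := by ring
      linarith [one_le_pow₀ (M₀ := ℝ) (a := 2) (n := n + 1) (by norm_num)])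
    refine (norm_scalingHat_le_octave hN n hn1 hn2.le).trans ?_
    calc 4 ^ N * ρ ^ n = 4 ^ N * ρ⁻¹ ^ 2 * ρ ^ (n + 2) := by rw [pow_add]; field_simp
      _ ≤ _ := by gcongr

/-! ### The scaling function -/

open FourierTransform

/-- `φ̂`, rescaled so that `φ` is its Fourier transform in Mathlib's normalization. -/
def scalingHatRescaled (N : ℕ) (η : ℝ) : ℂ := scalingHat N (-(2 * Real.pi) * η)

lemma integrable_scalingHatRescaled {N : ℕ} (hN : 2 ≤ N) :
    Integrable (scalingHatRescaled N) :=
  (integrable_scalingHat hN).comp_mul_left' (by simp [Real.pi_ne_zero])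

lemma scalingFun_eq (N : ℕ) (x : ℝ) : scalingFun N x = (𝓕 (scalingHatRescaled N) x).re := by
  rw [scalingFun, Real.fourier_real_eq_integral_exp_smul]
  congr 1
  have h := Measure.integral_comp_mul_left
    (fun ξ : ℝ => scalingHat N ξ * Complex.exp (Complex.I * (x * ξ))) (-(2 * Real.pi))
  rw [inv_neg, abs_neg, abs_of_pos (by positivity)] at h
  have h2 : (∫ v : ℝ, Complex.exp (↑(-2 * Real.pi * v * x) * Complex.I) •
      scalingHatRescaled N v) = ∫ v : ℝ, scalingHat N (-(2 * Real.pi) * v) *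
        Complex.exp (Complex.I * (x * (-(2 * Real.pi) * v : ℝ))) := by
    refine integral_congr_ae (Eventually.of_forall fun v => ?_)
    simp only [scalingHatRescaled, smul_eq_mul]
    rw [mul_comm]
    congr 2
    push_cast
    ring
  rw [h2, h, Complex.real_smul]
  push_cast
  rw [one_div]

lemma continuous_fourier_scalingHatRescaled {N : ℕ} (hN : 2 ≤ N) :
    Continuous (𝓕 (scalingHatRescaled N)) :=
  VectorFourier.fourierIntegral_continuous Real.continuous_fourierChar
    (by exact continuous_inner) (integrable_scalingHatRescaled hN)

lemma continuous_scalingFun {N : ℕ} (hN : 2 ≤ N) : Continuous (scalingFun N) := by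
  rw [funext (scalingFun_eq N)]
  exact Complex.continuous_re.comp (continuous_fourier_scalingHatRescaled hN)

lemma abs_scalingFun_le (N : ℕ) (x : ℝ) :
    |scalingFun N x| ≤ ∫ η, ‖scalingHatRescaled N η‖ := by
  rw [scalingFun_eq]
  exact (Complex.abs_re_le_norm _).trans
    (VectorFourier.norm_fourierIntegral_le_integral_norm _ _ _ _ _)

/-! ### Compact support of the scaling function -/

/-- The partial products are trigonometric polynomials with frequencies in `2^{-n}ℤ`, of degree at
most that of the symbol. -/
lemma scalingHatPartial_eq (N n : ℕ) : ∃ q : Polynomial ℂ,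
    q.natDegree ≤ (symbolPoly N).natDegree * 2 ^ n ∧
      ∀ ξ : ℝ, scalingHatPartial N n ξ
        = q.eval (Complex.exp (-(Complex.I * (ξ / 2 ^ n : ℝ)))) := by
  set D := (symbolPoly N).natDegree with hD
  -- The induction needs the sharper degree bound `D (2^n - 1)`, stated without subtraction.
  suffices h : ∃ q : Polynomial ℂ, q.natDegree + D ≤ D * 2 ^ n ∧
      ∀ ξ : ℝ, scalingHatPartial N n ξ
        = q.eval (Complex.exp (-(Complex.I * (ξ / 2 ^ n : ℝ)))) by
    obtain ⟨q, h1, h2⟩ := h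
    exact ⟨q, by omega, h2⟩
  induction n with
  | zero => exact ⟨1, by simp, fun ξ => by simp [scalingHatPartial]⟩
  | succ n ih =>
    obtain ⟨q, hq1, hq2⟩ := ih
    refine ⟨q.comp (Polynomial.X ^ 2) * symbolPoly N, ?_, fun ξ => ?_⟩
    · have h := Polynomial.natDegree_mul_le (p := q.comp (Polynomial.X ^ 2)) (q := symbolPoly N)
      rw [Polynomial.natDegree_comp, Polynomial.natDegree_X_pow, ← hD] at h
      have h2 : D * 2 ^ (n + 1) = D * 2 ^ n * 2 := by ring
      omega
    · have h := hq2 ξ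
      rw [scalingHatPartial] at h ⊢
      rw [Finset.prod_range_succ, h, Polynomial.eval_mul, ← symbol_eq_eval, Polynomial.eval_comp,
        Polynomial.eval_pow, Polynomial.eval_X, ← Complex.exp_nat_mul]
      congr 4
      push_cast
      field_simp
      ring

/-- Testing the `n`-th partial product against a Schwartz function that vanishes on
`[0, deg]` gives zero, as it is a combination of point evaluations there. -/
lemma integral_scalingHatPartial_mul (N n : ℕ) (g : SchwartzMap ℝ ℂ)
    (hg : ∀ x ∈ Set.Icc (0 : ℝ) (symbolPoly N).natDegree, g x = 0) :
    ∫ η : ℝ, scalingHatPartial N n (-(2 * Real.pi) * η) * 𝓕 (g : ℝ → ℂ) η = 0 := by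
  obtain ⟨q, hq1, hq2⟩ := scalingHatPartial_eq N n
  have hint : Integrable (𝓕 (g : ℝ → ℂ)) := by
    rw [← SchwartzMap.fourier_coe]; exact (𝓕 g).integrable
  have hev : ∀ t : ℝ, ∫ η : ℝ, Complex.exp (((2 * Real.pi * (η * t) : ℝ) : ℂ) * Complex.I) *
      𝓕 (g : ℝ → ℂ) η = g t := by
    intro t
    have h := congrFun (Continuous.fourierInv_fourier_eq g.continuous g.integrable hint) t
    rw [Real.fourierInv_eq'] at h
    simpa [mul_comm t] using h
  have h1 : ∀ η : ℝ, scalingHatPartial N n (-(2 * Real.pi) * η) * 𝓕 (g : ℝ → ℂ) η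
      = ∑ i ∈ Finset.range (q.natDegree + 1), q.coeff i *
        (Complex.exp (((2 * Real.pi * (η * (i / 2 ^ n : ℝ)) : ℝ) : ℂ) * Complex.I) *
          𝓕 (g : ℝ → ℂ) η) := by
    intro η
    rw [hq2, Polynomial.eval_eq_sum_range, Finset.sum_mul]
    refine Finset.sum_congr rfl fun i _ => ?_
    rw [← Complex.exp_nat_mul, mul_assoc]
    congr 3
    push_cast
    ring
  simp_rw [h1]
  rw [integral_finsetSum]
  · refine Finset.sum_eq_zero fun i hi => ?_
    rw [integral_const_mul, hev, hg, mul_zero]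
    refine ⟨by positivity, ?_⟩
    rw [div_le_iff₀ (by positivity)]
    rw [Finset.mem_range] at hi
    exact_mod_cast (Nat.lt_succ_iff.mp hi).trans hq1
  · intro i _
    refine Integrable.const_mul ?_ _
    refine hint.bdd_mul (c := 1) (Continuous.aestronglyMeasurable (by fun_prop))
      (Eventually.of_forall fun η => ?_)
    rw [Complex.norm_exp_ofReal_mul_I]

/-- Duality moves the Fourier transform onto `g`; there the partial products converge pointwise and
are bounded by 1, so `‖𝓕 g‖` dominates. -/
lemma integral_fourier_scalingHatRescaled_mul {N : ℕ} (hN : 2 ≤ N) (g : SchwartzMap ℝ ℂ)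
    (hg : ∀ x ∈ Set.Icc (0 : ℝ) (symbolPoly N).natDegree, g x = 0) :
    ∫ x : ℝ, 𝓕 (scalingHatRescaled N) x * g x = 0 := by
  have hint : Integrable (𝓕 (g : ℝ → ℂ)) := by
    rw [← SchwartzMap.fourier_coe]; exact (𝓕 g).integrable
  have h1 : ∫ x : ℝ, 𝓕 (scalingHatRescaled N) x * g x
      = ∫ η : ℝ, scalingHatRescaled N η * 𝓕 (g : ℝ → ℂ) η := by
    simpa using! VectorFourier.integral_fourierIntegral_smul_eq_flip (L := innerₗ ℝ)
      Real.continuous_fourierChar continuous_inner (integrable_scalingHatRescaled hN) g.integrable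
  rw [h1]
  have h2 : Tendsto (fun n => ∫ η : ℝ, scalingHatPartial N n (-(2 * Real.pi) * η) *
      𝓕 (g : ℝ → ℂ) η) atTop (𝓝 (∫ η : ℝ, scalingHatRescaled N η * 𝓕 (g : ℝ → ℂ) η)) := by
    refine tendsto_integral_of_dominated_convergence (fun η => ‖𝓕 (g : ℝ → ℂ) η‖) (fun n => ?_)
      hint.norm (fun n => Eventually.of_forall fun η => ?_) (Eventually.of_forall fun η => ?_)
    · refine AEStronglyMeasurable.mul (Continuous.aestronglyMeasurable ?_) hint.1
      unfold scalingHatPartial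
      refine continuous_finsetProd _ fun l _ => ?_
      simp only [symbol_eq_eval]
      exact (Polynomial.continuous _).comp (by fun_prop)
    · rw [norm_mul]
      exact mul_le_of_le_one_left (norm_nonneg _) (norm_scalingHatPartial_le_one hN _ _)
    · exact (tendsto_scalingHatPartial N _).mul_const _
  simp only [integral_scalingHatPartial_mul N _ g hg] at h2
  exact (tendsto_nhds_unique h2 tendsto_const_nhds)

/-- The scaling function is supported in `[0, deg]`. -/
lemma scalingFun_eq_zero {N : ℕ} (hN : 2 ≤ N) {x : ℝ}
    (hx : x ∉ Set.Icc (0 : ℝ) (symbolPoly N).natDegree) : scalingFun N x = 0 := by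
  set U : Set ℝ := (Set.Icc (0 : ℝ) (symbolPoly N).natDegree)ᶜ with hU
  have hUo : IsOpen U := isClosed_Icc.isOpen_compl
  have hc := continuous_fourier_scalingHatRescaled hN
  have hae : ∀ᵐ y : ℝ, y ∈ U → 𝓕 (scalingHatRescaled N) y = 0 := by
    refine hUo.ae_eq_zero_of_integral_contDiff_smul_eq_zero
      (hc.locallyIntegrable.locallyIntegrableOn U) fun g hg1 hg2 hg3 => ?_
    have hcs : HasCompactSupport fun y => (g y : ℂ) := hg2.comp_left Complex.ofReal_zero
    have := integral_fourier_scalingHatRescaled_mul hN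
      (hcs.toSchwartzMap (Complex.ofRealCLM.contDiff.comp hg1)) (fun y hy => by
        have : y ∉ tsupport g := fun h => hg3 h hy
        change (g y : ℂ) = 0
        rw [image_eq_zero_of_notMem_tsupport this, Complex.ofReal_zero])
    rw [← this]
    refine integral_congr_ae (Eventually.of_forall fun y => ?_)
    change g y • 𝓕 (scalingHatRescaled N) y = 𝓕 (scalingHatRescaled N) y * (g y : ℂ)
    rw [Complex.real_smul, mul_comm]
  -- By continuity, vanishing almost everywhere on `U` improves to vanishing everywhere: an open
  -- null set is empty.
  have hopen : IsOpen (U ∩ {y | 𝓕 (scalingHatRescaled N) y ≠ 0}) :=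
    hUo.inter (isOpen_ne_fun hc continuous_const)
  have hnull : volume (U ∩ {y | 𝓕 (scalingHatRescaled N) y ≠ 0}) = 0 := by
    refine measure_mono_null ?_ hae
    rintro y ⟨hy1, hy2⟩ h
    exact hy2 (h hy1)
  have hempty := hopen.measure_eq_zero_iff volume |>.mp hnull
  rw [scalingFun_eq]
  by_contra h
  have : x ∈ U ∩ {y | 𝓕 (scalingHatRescaled N) y ≠ 0} :=
    ⟨hx, fun h0 => h (by rw [h0, Complex.zero_re])⟩
  rw [hempty] at this
  exact this

/-! ### Spherical caps and stereographic projections -/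

open scoped Pointwise in
/-- Caps of radius `r` have measure at most a constant times `r^d`: the cone over a cap lies in a
tube of radius `2r` around a segment, which is covered by `O(1/r)` balls. -/
lemma surf_closedBall_le (d : ℕ) : ∃ C : ℝ, 0 ≤ C ∧ ∀ (p : Sph d) (r : ℝ), 0 < r →
    surf d (Metric.closedBall p r) ≤ ENNReal.ofReal (C * r ^ d) := by
  set V : ℝ := (volume (Metric.closedBall (0 : EuclideanSpace ℝ (Fin (d + 1))) 1)).toReal with hV
  have hVfin : volume (Metric.closedBall (0 : EuclideanSpace ℝ (Fin (d + 1))) 1) = ENNReal.ofReal V :=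
    (ENNReal.ofReal_toReal measure_closedBall_lt_top.ne).symm
  have hV0 : 0 ≤ V := ENNReal.toReal_nonneg
  have hdim : Module.finrank ℝ (EuclideanSpace ℝ (Fin (d + 1))) = d + 1 := by simp
  refine ⟨(d + 1) * (2 ^ (d + 2) * V), by positivity, fun p r hr => ?_⟩
  -- The surface measure of a set is `d + 1` times the volume of the cone over it.
  rw [surf, Measure.toSphere_apply' _ Metric.isClosed_closedBall.measurableSet, hdim]
  have key : volume (Set.Ioo (0 : ℝ) 1 • ((↑) '' Metric.closedBall p r : Set (EuclideanSpace ℝ (Fin (d + 1)))))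
      ≤ ENNReal.ofReal (2 ^ (d + 2) * V * r ^ d) := by
    rcases le_or_gt r 1 with hr1 | hr1
    · set n := ⌈1 / r⌉₊ with hn
      have hn1 : 1 / r ≤ n := Nat.le_ceil _
      have hn0 : (0 : ℝ) < n := lt_of_lt_of_le (by positivity) hn1
      have hn2 : (n : ℝ) ≤ 2 / r := by
        have h1 : (n : ℝ) < 1 / r + 1 := Nat.ceil_lt_add_one (by positivity)
        have h2 : 1 ≤ 1 / r := by rw [le_div_iff₀ hr]; linarith
        have h3 : 2 / r = 1 / r + 1 / r := by ring
        linarith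
      -- For `t • u` take `i = ⌊t n⌋`: the error is at most `|u - p| + 1/n ≤ 2r`.
      have hsub : Set.Ioo (0 : ℝ) 1 • ((↑) '' Metric.closedBall p r : Set (EuclideanSpace ℝ (Fin (d + 1))))
          ⊆ ⋃ i ∈ Finset.range n, Metric.closedBall (((i : ℝ) / n) • (p : EuclideanSpace ℝ (Fin (d + 1)))) (2 * r) := by
        rintro _ ⟨t, ⟨ht0, ht1⟩, _, ⟨u, hu, rfl⟩, rfl⟩
        have hfl : (⌊t * n⌋₊ : ℝ) ≤ t * n := Nat.floor_le (by positivity)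
        have hfl2 : t * n < ⌊t * n⌋₊ + 1 := Nat.lt_floor_add_one _
        have hlt : ⌊t * n⌋₊ < n := by
          have : (⌊t * n⌋₊ : ℝ) < n := by nlinarith
          exact_mod_cast this
        refine Set.mem_iUnion₂.mpr ⟨⌊t * n⌋₊, Finset.mem_range.mpr hlt, ?_⟩
        rw [Metric.mem_closedBall, dist_eq_norm]
        have hp : ‖(p : EuclideanSpace ℝ (Fin (d + 1)))‖ = 1 := mem_sphere_zero_iff_norm.mp p.2
        have hu' : ‖(u : EuclideanSpace ℝ (Fin (d + 1))) - p‖ ≤ r := by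
          rw [← dist_eq_norm]; exact hu
        have h1 : t • (u : EuclideanSpace ℝ (Fin (d + 1))) - ((⌊t * n⌋₊ : ℝ) / n) • (p : EuclideanSpace ℝ (Fin (d + 1)))
            = t • ((u : EuclideanSpace ℝ (Fin (d + 1))) - p) + (t - (⌊t * n⌋₊ : ℝ) / n) • (p : EuclideanSpace ℝ (Fin (d + 1))) := by
          rw [smul_sub, sub_smul]; abel
        have h2 : t - (⌊t * n⌋₊ : ℝ) / n = (t * n - ⌊t * n⌋₊) / n := by field_simp
        have h3 : |t - (⌊t * n⌋₊ : ℝ) / n| ≤ r := by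
          rw [h2, abs_of_nonneg (div_nonneg (by linarith) hn0.le)]
          rw [div_le_iff₀ hr] at hn1
          rw [div_le_iff₀ hn0]
          linarith
        rw [h1]
        refine (norm_add_le _ _).trans ?_
        rw [norm_smul, norm_smul, hp, mul_one, Real.norm_of_nonneg ht0.le, Real.norm_eq_abs]
        nlinarith [norm_nonneg ((u : EuclideanSpace ℝ (Fin (d + 1))) - p)]
      refine (measure_mono hsub).trans ((measure_biUnion_finset_le _ _).trans ?_)
      have hball : ∀ i ∈ Finset.range n,
          volume (Metric.closedBall (((i : ℝ) / n) • (p : EuclideanSpace ℝ (Fin (d + 1)))) (2 * r))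
            = ENNReal.ofReal ((2 * r) ^ (d + 1) * V) := by
        intro i _
        rw [Measure.addHaar_closedBall' _ _ (by positivity), hdim, hVfin,
          ENNReal.ofReal_mul (by positivity)]
      rw [Finset.sum_congr rfl hball, Finset.sum_const, Finset.card_range, nsmul_eq_mul,
        ← ENNReal.ofReal_natCast, ← ENNReal.ofReal_mul (by positivity)]
      refine ENNReal.ofReal_le_ofReal ?_
      calc (n : ℝ) * ((2 * r) ^ (d + 1) * V) ≤ 2 / r * ((2 * r) ^ (d + 1) * V) := by gcongr
        _ = 2 ^ (d + 2) * V * r ^ d := by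
            rw [mul_pow, pow_succ r d]; field_simp; ring
    · have hsub : Set.Ioo (0 : ℝ) 1 • ((↑) '' Metric.closedBall p r : Set (EuclideanSpace ℝ (Fin (d + 1))))
          ⊆ Metric.closedBall (0 : EuclideanSpace ℝ (Fin (d + 1))) 1 := by
        rintro _ ⟨t, ⟨ht0, ht1⟩, _, ⟨u, hu, rfl⟩, rfl⟩
        have hu1 : ‖(u : EuclideanSpace ℝ (Fin (d + 1)))‖ = 1 := mem_sphere_zero_iff_norm.mp u.2
        simp only [mem_closedBall_zero_iff, norm_smul, hu1, mul_one, Real.norm_of_nonneg ht0.le]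
        exact ht1.le
      refine (measure_mono hsub).trans ?_
      rw [hVfin]
      refine ENNReal.ofReal_le_ofReal ?_
      have h1 : (1 : ℝ) ≤ 2 ^ (d + 2) := one_le_pow₀ (by norm_num)
      have h2 : (1 : ℝ) ≤ r ^ d := one_le_pow₀ hr1.le
      calc V = 1 * V * 1 := by ring
        _ ≤ _ := by gcongr
  have hd : ((d + 1 : ℕ) : ENNReal) = ENNReal.ofReal ((d : ℝ) + 1) := by
    rw [← ENNReal.ofReal_natCast]; push_cast; rfl
  rw [hd]
  refine (mul_le_mul_right key _).trans (le_of_eq ?_)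
  rw [← ENNReal.ofReal_mul (by positivity)]
  congr 1
  ring

lemma surf_le_of_dist_le (d : ℕ) : ∃ C : ℝ, 0 ≤ C ∧ ∀ (A : Set (Sph d)) (r : ℝ), 0 < r →
    (∀ u ∈ A, ∀ v ∈ A, dist u v ≤ r) → surf d A ≤ ENNReal.ofReal (C * r ^ d) := by
  obtain ⟨C, hC0, hC⟩ := surf_closedBall_le d
  refine ⟨C, hC0, fun A r hr hA => ?_⟩
  rcases A.eq_empty_or_nonempty with rfl | ⟨p, hp⟩
  · simp
  · exact (measure_mono fun u hu => hA u hu p hp).trans (hC p r hr)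

/-! ### Metric comparison under stereographic projection -/

/-- The stereographic projections `S_τ` for `τ = ±1`. -/
def stereo {d : ℕ} (τ : ℝ) (u : Sph d) : Fin d → ℝ :=
  fun i => (u : EuclideanSpace ℝ (Fin (d + 1))) i.castSucc / (1 + τ * height u)

lemma stereoPlus_eq {d : ℕ} (u : Sph d) : stereoPlus u = stereo 1 u := by
  funext i
  simp [stereoPlus, stereo]

lemma stereoMinus_eq {d : ℕ} (u : Sph d) : stereoMinus u = stereo (-1) u := by
  funext i
  simp [stereoMinus, stereo, sub_eq_add_neg]

lemma sum_sq_add_height_sq {d : ℕ} (u : Sph d) :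
    ∑ i : Fin d, (u : EuclideanSpace ℝ (Fin (d + 1))) i.castSucc ^ 2 + height u ^ 2 = 1 := by
  have h : ‖(u : EuclideanSpace ℝ (Fin (d + 1)))‖ = 1 := mem_sphere_zero_iff_norm.mp u.2
  have h2 := EuclideanSpace.norm_sq_eq (u : EuclideanSpace ℝ (Fin (d + 1)))
  rw [h, Fin.sum_univ_castSucc] at h2
  simpa [height] using h2.symm

lemma dist_sq_eq {d : ℕ} (u v : Sph d) :
    dist u v ^ 2 = ∑ i : Fin d, ((u : EuclideanSpace ℝ (Fin (d + 1))) i.castSucc -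
      (v : EuclideanSpace ℝ (Fin (d + 1))) i.castSucc) ^ 2 + (height u - height v) ^ 2 := by
  rw [Subtype.dist_eq, dist_eq_norm, EuclideanSpace.norm_sq_eq, Fin.sum_univ_castSucc]
  simp [height]

lemma one_add_height_bounds {d : ℕ} {τ : ℝ} (hτ : τ ^ 2 = 1) (u : Sph d) :
    0 ≤ 1 + τ * height u ∧ 1 + τ * height u ≤ 2 := by
  have h1 : height u ^ 2 ≤ 1 := by
    rw [← sum_sq_add_height_sq u]
    exact le_add_of_nonneg_left (Finset.sum_nonneg fun _ _ => sq_nonneg _)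
  have h2 : |τ * height u| ≤ 1 := by
    rw [← sq_le_one_iff_abs_le_one, mul_pow, hτ, one_mul]; exact h1
  rw [abs_le] at h2
  constructor <;> linarith

/-- Away from the poles, the inverse stereographic projections are Lipschitz with constant 2. -/
lemma dist_sq_le_stereo {d : ℕ} {τ : ℝ} (hτ : τ ^ 2 = 1) {u v : Sph d}
    (hu : 1 + τ * height u ≠ 0) (hv : 1 + τ * height v ≠ 0) :
    dist u v ^ 2 ≤ 4 * ∑ i, (stereo τ u i - stereo τ v i) ^ 2 := by
  obtain ⟨hα0, hα2⟩ := one_add_height_bounds hτ u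
  obtain ⟨hβ0, hβ2⟩ := one_add_height_bounds hτ v
  have hsu := sum_sq_add_height_sq u
  have hsv := sum_sq_add_height_sq v
  rw [dist_sq_eq]
  simp only [stereo]
  set h := height u
  set k := height v
  set α := 1 + τ * h with hα
  set β := 1 + τ * k with hβ
  set a : Fin d → ℝ := fun i => (u : EuclideanSpace ℝ (Fin (d + 1))) i.castSucc with ha
  set b : Fin d → ℝ := fun i => (v : EuclideanSpace ℝ (Fin (d + 1))) i.castSucc with hb
  change ∑ i, (a i - b i) ^ 2 + (h - k) ^ 2 ≤ 4 * ∑ i, (a i / α - b i / β) ^ 2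
  change ∑ i, a i ^ 2 + h ^ 2 = 1 at hsu
  change ∑ i, b i ^ 2 + k ^ 2 = 1 at hsv
  have e1 : ∑ i, (a i - b i) ^ 2 = ∑ i, a i ^ 2 - 2 * ∑ i, a i * b i + ∑ i, b i ^ 2 := by
    rw [Finset.mul_sum, ← Finset.sum_sub_distrib, ← Finset.sum_add_distrib]
    exact Finset.sum_congr rfl fun i _ => by ring
  have e2 : α * β * ∑ i, (a i / α - b i / β) ^ 2
      = β / α * ∑ i, a i ^ 2 - 2 * ∑ i, a i * b i + α / β * ∑ i, b i ^ 2 := by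
    rw [Finset.mul_sum, Finset.mul_sum, Finset.mul_sum, Finset.mul_sum,
      ← Finset.sum_sub_distrib, ← Finset.sum_add_distrib]
    exact Finset.sum_congr rfl fun i _ => by field_simp; ring
  have e3 : ∑ i, a i ^ 2 = α * (2 - α) := by
    rw [hα]; linear_combination hsu + h ^ 2 * hτ
  have e4 : ∑ i, b i ^ 2 = β * (2 - β) := by
    rw [hβ]; linear_combination hsv + k ^ 2 * hτ
  -- Conformality as an exact identity, `|u - v|² = αβ |S u - S v|²`, with `α, β ≤ 2`.
  have e5 : ∑ i, (a i - b i) ^ 2 + (h - k) ^ 2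
      = α * β * ∑ i, (a i / α - b i / β) ^ 2 := by
    rw [e1, e2, e3, e4]
    have : β / α * (α * (2 - α)) + α / β * (β * (2 - β)) = β * (2 - α) + α * (2 - β) := by
      field_simp
    have h3 : α * (2 - α) + h ^ 2 = 1 := by rw [← e3]; exact hsu
    have h4 : β * (2 - β) + k ^ 2 = 1 := by rw [← e4]; exact hsv
    have h5 : (α - 1) * (β - 1) = h * k := by
      rw [hα, hβ]; linear_combination h * k * hτ
    linear_combination h3 + h4 - this + 2 * h5
  rw [e5]
  have : α * β ≤ 4 := by nlinarith
  exact mul_le_mul_of_nonneg_right this (Finset.sum_nonneg fun _ _ => sq_nonneg _)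

/-- Preimages of cubes of side `2ρ` under the stereographic projections have measure
`O(ρ^d)`. -/
lemma surf_stereo_preimage_le (d : ℕ) : ∃ C : ℝ, 0 ≤ C ∧ ∀ τ : ℝ, τ ^ 2 = 1 →
    ∀ (c : Fin d → ℝ) (ρ : ℝ), 0 < ρ →
      surf d {u | ∀ i, |stereo τ u i - c i| ≤ ρ} ≤ ENNReal.ofReal (C * ρ ^ d) := by
  obtain ⟨C, hC0, hC⟩ := surf_le_of_dist_le d
  -- The projections differ by at most `2ρ` per coordinate, so the points by at most `4√d ρ`; the `+
  -- 1` keeps the radius positive for every `d`.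
  set κ : ℝ := 4 * Real.sqrt d + 1 with hκ
  have hκ0 : 0 < κ := by positivity
  refine ⟨C * κ ^ d + C * κ ^ d, by positivity, fun τ hτ c ρ hρ => ?_⟩
  set A : Set (Sph d) := {u | ∀ i, |stereo τ u i - c i| ≤ ρ} with hA
  have hκρ : 0 < κ * ρ := by positivity
  have h1 : surf d (A ∩ {u | 1 + τ * height u ≠ 0}) ≤ ENNReal.ofReal (C * (κ * ρ) ^ d) := by
    refine hC _ _ hκρ fun u hu v hv => ?_
    have h := dist_sq_le_stereo hτ hu.2 hv.2
    have h2 : ∑ i, (stereo τ u i - stereo τ v i) ^ 2 ≤ ∑ _i : Fin d, (2 * ρ) ^ 2 := by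
      refine Finset.sum_le_sum fun i _ => ?_
      rw [sq_le_sq, abs_of_pos (show 0 < 2 * ρ by positivity)]
      have := abs_sub_le (stereo τ u i) (c i) (stereo τ v i)
      have h3 := hu.1 i
      have h4 := hv.1 i
      rw [abs_sub_comm] at h4
      linarith
    rw [Finset.sum_const, Finset.card_univ, Fintype.card_fin, nsmul_eq_mul] at h2
    have h3 : dist u v ^ 2 ≤ (4 * Real.sqrt d * ρ) ^ 2 := by
      rw [mul_pow, mul_pow, Real.sq_sqrt (Nat.cast_nonneg d)]
      linarith
    have h4 := (le_abs_self _).trans (abs_le_of_sq_le_sq h3 (by positivity))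
    rw [hκ]
    nlinarith [h4]
  -- At the pole, division by zero gives `stereo` the value 0, so the pole may belong to `A`. It is
  -- a single point, hence of diameter zero.
  have h2 : surf d (A ∩ {u | ¬ (1 + τ * height u ≠ 0)}) ≤ ENNReal.ofReal (C * (κ * ρ) ^ d) := by
    refine hC _ _ hκρ fun u hu v hv => ?_
    have hpole : ∀ w : Sph d, ¬ (1 + τ * height w ≠ 0) → height w = -τ ∧
        ∀ i : Fin d, (w : EuclideanSpace ℝ (Fin (d + 1))) i.castSucc = 0 := by
      intro w hw
      rw [not_not] at hw
      have h1 : height w = -τ := by linear_combination τ * hw - height w * hτ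
      refine ⟨h1, fun i => ?_⟩
      have h2 := sum_sq_add_height_sq w
      rw [h1, neg_sq, hτ, add_eq_right] at h2
      have h3 := (Finset.sum_eq_zero_iff_of_nonneg fun i _ => sq_nonneg _).mp h2 i
        (Finset.mem_univ i)
      exact pow_eq_zero_iff (two_ne_zero) |>.mp h3
    obtain ⟨hu1, hu2⟩ := hpole u hu.2
    obtain ⟨hv1, hv2⟩ := hpole v hv.2
    have h := dist_sq_eq u v
    simp only [hu1, hu2, hv1, hv2, sub_self] at h
    have h0 : dist u v = 0 := by
      rw [← pow_eq_zero_iff (two_ne_zero), h]; simp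
    rw [h0]
    exact hκρ.le
  calc surf d A ≤ surf d (A ∩ {u | 1 + τ * height u ≠ 0} ∪
        A ∩ {u | ¬ (1 + τ * height u ≠ 0)}) := by
        refine measure_mono fun u hu => ?_
        by_cases h : 1 + τ * height u ≠ 0
        · exact Or.inl ⟨hu, h⟩
        · exact Or.inr ⟨hu, h⟩
    _ ≤ _ := measure_union_le _ _
    _ ≤ _ := add_le_add h1 h2
    _ = _ := by
        rw [← ENNReal.ofReal_add (by positivity) (by positivity), mul_pow]
        congr 1
        ring

lemma measurable_height {d : ℕ} : Measurable (height : Sph d → ℝ) := by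
  unfold height
  fun_prop

lemma measurable_angle {d : ℕ} : Measurable (angle : Sph d → ℝ) :=
  Real.measurable_arccos.comp measurable_height

lemma measurable_stereo {d : ℕ} (τ : ℝ) : Measurable (stereo τ : Sph d → Fin d → ℝ) := by
  refine measurable_pi_lambda _ fun i => ?_
  unfold stereo
  refine Measurable.div (by fun_prop) ?_
  exact (measurable_height.const_mul τ).const_add 1

/-! ### The kernel -/

/-- An integer bound for the length of the support of the scaling function. -/
def suppLen (N : ℕ) : ℕ := (symbolPoly N).natDegree

/-- `x` lies in the cube `2^{-j}(k + [0, R]^d)` that contains the support of `ψ_I`. -/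
def InCube (N : ℕ) {d : ℕ} (j : ℤ) (k : Fin d → ℤ) (x : Fin d → ℝ) : Prop :=
  ∀ i, (2 : ℝ) ^ j * x i - k i ∈ Set.Icc (0 : ℝ) (suppLen N)

lemma scaledFun_eq_zero {N d : ℕ} (hN : 2 ≤ N) {j : ℤ} {k : Fin d → ℤ} {x : Fin d → ℝ}
    (h : ¬ InCube N j k x) : scaledFun N d j k x = 0 := by
  obtain ⟨i, hi⟩ := not_forall.mp h
  rw [scaledFun, Finset.prod_eq_zero (Finset.mem_univ i) (scalingFun_eq_zero hN hi), mul_zero]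

/-- On the cubes in `𝒟_j` the Jacobian is bounded below, so `ψ_I / √J = O(2^{jd/2})`. -/
lemma scaledFun_div_sqrt_jac_le (N d : ℕ) {ε : ℝ} (hε : 0 < ε) : ∃ C : ℝ, 0 ≤ C ∧
    ∀ j : ℤ, ∀ k ∈ cubes N d ε j, ∀ x : Fin d → ℝ,
      |scaledFun N d j k x / Real.sqrt (jac x)| ≤ C * (2 : ℝ) ^ ((j : ℝ) * (d : ℝ) / 2) := by
  set M : ℝ := ∫ η, ‖scalingHatRescaled N η‖ with hM
  have hM0 : 0 ≤ M := integral_nonneg fun _ => norm_nonneg _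
  set κ : ℝ := Real.sqrt ((2 / (1 + d * (1 + ε) ^ 2)) ^ d) with hκ
  have hκ0 : 0 < κ := by positivity
  refine ⟨M ^ d / κ, by positivity, fun j k hk x => ?_⟩
  by_cases hx : scaledFun N d j k x = 0
  · rw [hx, zero_div, abs_zero]; positivity
  · have hbox : x ∈ Set.Icc (fun _ => -1 - ε) (fun _ : Fin d => 1 + ε) :=
      hk (subset_tsupport _ hx)
    have hsum : ∑ i, x i ^ 2 ≤ d * (1 + ε) ^ 2 := by
      have : ∑ i, x i ^ 2 ≤ ∑ _i : Fin d, (1 + ε) ^ 2 := by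
        refine Finset.sum_le_sum fun i _ => ?_
        have h1 := hbox.1 i
        have h2 := hbox.2 i
        simp only at h1 h2
        nlinarith
      simpa using this
    have hs0 : 0 ≤ ∑ i, x i ^ 2 := Finset.sum_nonneg fun _ _ => sq_nonneg _
    have hjac : κ ≤ Real.sqrt (jac x) := by
      rw [hκ, jac]
      gcongr
    have hprod : |scaledFun N d j k x| ≤ (2 : ℝ) ^ ((j : ℝ) * (d : ℝ) / 2) * M ^ d := by
      rw [scaledFun, abs_mul, abs_of_pos (by positivity), Finset.abs_prod]
      gcongr
      refine (Finset.prod_le_prod (fun _ _ => abs_nonneg _)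
        fun i _ => abs_scalingFun_le N _).trans (le_of_eq ?_)
      simp [hM]
    rw [abs_div, abs_of_nonneg (Real.sqrt_nonneg _)]
    calc |scaledFun N d j k x| / Real.sqrt (jac x)
        ≤ (2 : ℝ) ^ ((j : ℝ) * (d : ℝ) / 2) * M ^ d / κ := by gcongr
      _ = _ := by ring

/-! ### Pointwise bounds for the localized functions -/

lemma height_reflect {d : ℕ} (u : Sph d) : height (reflect u) = -height u := by
  simp [height, reflect]

lemma reflect_castSucc {d : ℕ} (u : Sph d) (i : Fin d) :
    (reflect u : EuclideanSpace ℝ (Fin (d + 1))) i.castSucc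
      = (u : EuclideanSpace ℝ (Fin (d + 1))) i.castSucc := by
  simp [reflect, (Fin.castSucc_lt_last i).ne]

lemma stereoPlus_reflect {d : ℕ} (u : Sph d) : stereoPlus (reflect u) = stereoMinus u := by
  funext i
  rw [stereoPlus, stereoMinus, height_reflect, reflect_castSucc, sub_eq_add_neg]

lemma stereoMinus_reflect {d : ℕ} (u : Sph d) : stereoMinus (reflect u) = stereoPlus u := by
  funext i
  rw [stereoPlus, stereoMinus, height_reflect, reflect_castSucc, sub_neg_eq_add]

/-- Reflection exchanges the two charts, so `E⁺T⁺ψ` and `E⁻T⁻ψ` are both controlled by the same pair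
`T⁺ψ(u)`, `T⁻ψ(u)`. -/
lemma transPlus_reflect {d : ℕ} (ψ : (Fin d → ℝ) → ℝ) (u : Sph d) :
    transPlus ψ (reflect u) = transMinus ψ u := by
  rw [transPlus, transMinus, stereoPlus_reflect]

lemma transMinus_reflect {d : ℕ} (ψ : (Fin d → ℝ) → ℝ) (u : Sph d) :
    transMinus ψ (reflect u) = transPlus ψ u := by
  rw [transPlus, transMinus, stereoMinus_reflect]

/-- All coefficients are at most 1 because `|s| ≤ 1`. The bound covers the three zones of `θ` at
once, so they need not be distinguished again. -/
lemma abs_aww_le {d : ℕ} {δ : ℝ} {s : ℝ → ℝ} (hs : ∀ t : ℝ, s t ^ 2 + s (-t) ^ 2 = 1)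
    (g : Sph d → ℝ) (u : Sph d) : |aww δ s g u| ≤ |g u| + |g (reflect u)| := by
  have h1 : ∀ t, |s t| ≤ 1 := fun t => by
    rw [← sq_le_one_iff_abs_le_one]
    nlinarith [hs t, sq_nonneg (s (-t))]
  unfold aww
  split_ifs
  · exact le_add_of_nonneg_right (abs_nonneg _)
  · rw [abs_zero]; positivity
  · refine (abs_add_le _ _).trans (add_le_add ?_ ?_)
    · rw [abs_mul, abs_pow]
      exact mul_le_of_le_one_left (abs_nonneg _) (pow_le_one₀ (abs_nonneg _) (h1 _))
    · rw [abs_mul, abs_mul]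
      exact mul_le_of_le_one_left (abs_nonneg _) (mul_le_one₀ (h1 _) (abs_nonneg _) (h1 _))

lemma abs_awwPlus_le {d : ℕ} {δ : ℝ} {s : ℝ → ℝ} (hs : ∀ t : ℝ, s t ^ 2 + s (-t) ^ 2 = 1)
    (g : Sph d → ℝ) (u : Sph d) : |awwPlus δ s g u| ≤ 2 * (|g u| + |g (reflect u)|) := by
  have h1 := abs_aww_le (δ := δ) hs g u
  have h2 := abs_sub (g u) (aww δ s g u)
  rw [awwPlus]
  linarith [abs_nonneg (g (reflect u))]

lemma abs_awwPlus_transPlus_le {d : ℕ} {δ : ℝ} {s : ℝ → ℝ}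
    (hs : ∀ t : ℝ, s t ^ 2 + s (-t) ^ 2 = 1) (ψ : (Fin d → ℝ) → ℝ) (u : Sph d) :
    |awwPlus δ s (transPlus ψ) u| ≤ 2 * (|transPlus ψ u| + |transMinus ψ u|) := by
  rw [← transPlus_reflect]
  exact abs_awwPlus_le hs _ _

lemma abs_awwMinus_transMinus_le {d : ℕ} {δ : ℝ} {s : ℝ → ℝ}
    (hs : ∀ t : ℝ, s t ^ 2 + s (-t) ^ 2 = 1) (ψ : (Fin d → ℝ) → ℝ) (u : Sph d) :
    |awwMinus δ s (transMinus ψ) u| ≤ 2 * (|transPlus ψ u| + |transMinus ψ u|) := by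
  rw [← transMinus_reflect, add_comm]
  refine (abs_aww_le hs _ _).trans ?_
  linarith [abs_nonneg (transMinus ψ u), abs_nonneg (transMinus ψ (reflect u))]

/-- One of the stereographic projections of `u` lies in the cube belonging to `k`. -/
def Near (N : ℕ) {d : ℕ} (j : ℤ) (k : Fin d → ℤ) (u : Sph d) : Prop :=
  ∃ τ : ℝ, (τ = 1 ∨ τ = -1) ∧ InCube N j k (stereo τ u)

lemma trans_eq_zero {N d : ℕ} (hN : 2 ≤ N) {j : ℤ} {k : Fin d → ℤ} {u : Sph d}
    (h : ¬ Near N j k u) : transPlus (scaledFun N d j k) u = 0 ∧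
      transMinus (scaledFun N d j k) u = 0 := by
  constructor
  · rw [transPlus, stereoPlus_eq, scaledFun_eq_zero hN fun h1 => h ⟨1, Or.inl rfl, h1⟩, zero_div]
  · rw [transMinus, stereoMinus_eq, scaledFun_eq_zero hN fun h1 => h ⟨-1, Or.inr rfl, h1⟩,
      zero_div]

/-- The summand of the kernel belonging to the cube `k`. -/
def kernelTerm (N d : ℕ) (δ : ℝ) (s : ℝ → ℝ) (j : ℤ) (x y : Sph d) (k : Fin d → ℤ) : ℝ :=
  awwPlus δ s (transPlus (scaledFun N d j k)) x *
      awwPlus δ s (transPlus (scaledFun N d j k)) y +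
    awwMinus δ s (transMinus (scaledFun N d j k)) x *
      awwMinus δ s (transMinus (scaledFun N d j k)) y

lemma kernelTerm_eq_zero {N d : ℕ} (hN : 2 ≤ N) {δ : ℝ} {s : ℝ → ℝ}
    (hs : ∀ t : ℝ, s t ^ 2 + s (-t) ^ 2 = 1) {j : ℤ} {x y : Sph d} {k : Fin d → ℤ}
    (h : ¬ (Near N j k x ∧ Near N j k y)) : kernelTerm N d δ s j x y k = 0 := by
  have key : ∀ u : Sph d, ¬ Near N j k u →
      awwPlus δ s (transPlus (scaledFun N d j k)) u = 0 ∧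
        awwMinus δ s (transMinus (scaledFun N d j k)) u = 0 := by
    intro u hu
    obtain ⟨h1, h2⟩ := trans_eq_zero hN hu
    have h3 := abs_awwPlus_transPlus_le (δ := δ) hs (scaledFun N d j k) u
    have h4 := abs_awwMinus_transMinus_le (δ := δ) hs (scaledFun N d j k) u
    rw [h1, h2, abs_zero, add_zero, mul_zero, abs_nonpos_iff] at h3 h4
    exact ⟨h3, h4⟩
  rw [kernelTerm]
  rcases not_and_or.mp h with h | h <;> obtain ⟨h1, h2⟩ := key _ h <;> rw [h1, h2] <;> ring

lemma abs_kernelTerm_le (N d : ℕ) {ε : ℝ} (hε : 0 < ε) (δ : ℝ) {s : ℝ → ℝ}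
    (hs : ∀ t : ℝ, s t ^ 2 + s (-t) ^ 2 = 1) : ∃ C : ℝ, 0 ≤ C ∧
    ∀ j : ℤ, ∀ k ∈ cubes N d ε j, ∀ x y : Sph d,
      |kernelTerm N d δ s j x y k| ≤ C * (2 : ℝ) ^ (j * (d : ℤ)) := by
  obtain ⟨C, hC0, hC⟩ := scaledFun_div_sqrt_jac_le N d hε
  -- Each of the four factors is at most `2(CB + CB) = 4CB`; two products of two give `32 C² B²`,
  -- and `B² = 2^{jd}`.
  refine ⟨32 * C ^ 2, by positivity, fun j k hk x y => ?_⟩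
  set B : ℝ := (2 : ℝ) ^ ((j : ℝ) * (d : ℝ) / 2) with hB
  have hBB : B * B = (2 : ℝ) ^ (j * (d : ℤ)) := by
    rw [hB, ← Real.rpow_add (by norm_num), add_halves, ← Real.rpow_intCast]
    push_cast; rfl
  have h : ∀ u : Sph d, 2 * (|transPlus (scaledFun N d j k) u| +
      |transMinus (scaledFun N d j k) u|) ≤ 4 * (C * B) := fun u => by
    have h1 := hC j k hk (stereoPlus u)
    have h2 := hC j k hk (stereoMinus u)
    rw [transPlus, transMinus]
    linarith
  have hp : ∀ u, |awwPlus δ s (transPlus (scaledFun N d j k)) u| ≤ 4 * (C * B) := fun u =>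
    (abs_awwPlus_transPlus_le hs _ u).trans (h u)
  have hm : ∀ u, |awwMinus δ s (transMinus (scaledFun N d j k)) u| ≤ 4 * (C * B) := fun u =>
    (abs_awwMinus_transMinus_le hs _ u).trans (h u)
  have h0 : 0 ≤ 4 * (C * B) := (abs_nonneg _).trans (hp x)
  rw [kernelTerm, ← hBB]
  refine (abs_add_le _ _).trans ?_
  rw [abs_mul, abs_mul]
  calc _ ≤ 4 * (C * B) * (4 * (C * B)) + 4 * (C * B) * (4 * (C * B)) :=
        add_le_add (mul_le_mul (hp x) (hp y) (abs_nonneg _) h0)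
          (mul_le_mul (hm x) (hm y) (abs_nonneg _) h0)
    _ = 32 * C ^ 2 * (B * B) := by ring

/-! ### Counting the contributing cubes -/

/-- The indices of the cubes near a point of `ℝ^d`. -/
def nearIndices (N : ℕ) {d : ℕ} (j : ℤ) (x : Fin d → ℝ) : Finset (Fin d → ℤ) :=
  Fintype.piFinset fun i => Finset.Icc (⌈(2 : ℝ) ^ j * x i⌉ - suppLen N) ⌊(2 : ℝ) ^ j * x i⌋

lemma mem_nearIndices {N d : ℕ} {j : ℤ} {k : Fin d → ℤ} {x : Fin d → ℝ}
    (h : InCube N j k x) : k ∈ nearIndices N j x := by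
  rw [nearIndices, Fintype.mem_piFinset]
  intro i
  obtain ⟨h1, h2⟩ := h i
  rw [Finset.mem_Icc, sub_le_iff_le_add, Int.ceil_le, Int.le_floor]
  push_cast
  constructor <;> linarith

lemma card_nearIndices_le (N : ℕ) {d : ℕ} (j : ℤ) (x : Fin d → ℝ) :
    (nearIndices N j x).card ≤ (suppLen N + 1) ^ d := by
  rw [nearIndices, Fintype.card_piFinset]
  refine (Finset.prod_le_pow_card _ _ (suppLen N + 1) fun i _ => ?_).trans (by simp)
  rw [Int.card_Icc]
  have := Int.floor_le_ceil ((2 : ℝ) ^ j * x i)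
  omega

/-- The cube must contain a projection of `y`, so one finite set serves all `x`; the factor 2 counts
the two projections. -/
lemma kernel_eq_sum {N d : ℕ} (hN : 2 ≤ N) {δ : ℝ} {s : ℝ → ℝ}
    (hs : ∀ t : ℝ, s t ^ 2 + s (-t) ^ 2 = 1) (ε : ℝ) (j : ℤ) (y : Sph d) :
    ∃ F : Finset (Fin d → ℤ), F.card ≤ 2 * (suppLen N + 1) ^ d ∧ (∀ k ∈ F, k ∈ cubes N d ε j) ∧
      ∀ x, kernel N d δ s ε j x y = ∑ k ∈ F, kernelTerm N d δ s j x y k := by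
  classical
  refine ⟨(nearIndices N j (stereo 1 y) ∪ nearIndices N j (stereo (-1) y)).filter
    (· ∈ cubes N d ε j), ?_, fun k hk => (Finset.mem_filter.mp hk).2, fun x => ?_⟩
  · refine (Finset.card_filter_le _ _).trans ((Finset.card_union_le _ _).trans ?_)
    have h1 := card_nearIndices_le N j (stereo 1 y)
    have h2 := card_nearIndices_le N j (stereo (-1) y)
    omega
  · change ∑ᶠ k ∈ cubes N d ε j, kernelTerm N d δ s j x y k = _
    refine finsum_mem_eq_sum_of_inter_support_eq _ ?_
    ext k
    simp only [Set.mem_inter_iff, Function.mem_support, Finset.coe_filter, Finset.mem_union,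
      Set.mem_ofPred_eq]
    refine ⟨fun ⟨hk, h0⟩ => ⟨⟨?_, hk⟩, h0⟩, fun ⟨⟨_, hk⟩, h0⟩ => ⟨hk, h0⟩⟩
    by_contra hcon
    refine h0 (kernelTerm_eq_zero hN hs fun ⟨_, τ, hτ, hc⟩ => hcon ?_)
    rcases hτ with rfl | rfl
    · exact Or.inl (mem_nearIndices hc)
    · exact Or.inr (mem_nearIndices hc)

/-! ### Support of the kernel in the first variable -/

/-- The points one of whose stereographic projections is within `ρ` of one of those of `y`. -/
def nearSet {d : ℕ} (ρ : ℝ) (y : Sph d) : Set (Sph d) :=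
  ({x | ∀ i, |stereo 1 x i - stereo 1 y i| ≤ ρ} ∪ {x | ∀ i, |stereo 1 x i - stereo (-1) y i| ≤ ρ}) ∪
  ({x | ∀ i, |stereo (-1) x i - stereo 1 y i| ≤ ρ} ∪
    {x | ∀ i, |stereo (-1) x i - stereo (-1) y i| ≤ ρ})

lemma measurableSet_nearSet {d : ℕ} (ρ : ℝ) (y : Sph d) : MeasurableSet (nearSet ρ y) := by
  have h : ∀ (τ : ℝ) (c : Fin d → ℝ),
      MeasurableSet {x : Sph d | ∀ i, |stereo τ x i - c i| ≤ ρ} := fun τ c => by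
    simp only [Set.ofPred_forall]
    refine MeasurableSet.iInter fun i => ?_
    have h1 : Measurable fun x : Sph d => stereo τ x i :=
      (measurable_pi_apply i).comp (measurable_stereo τ)
    exact measurableSet_le (h1.sub_const _).abs measurable_const
  exact ((h _ _).union (h _ _)).union ((h _ _).union (h _ _))

lemma surf_nearSet_le (d : ℕ) : ∃ C : ℝ, 0 ≤ C ∧ ∀ (y : Sph d) (ρ : ℝ), 0 < ρ →
    surf d (nearSet ρ y) ≤ ENNReal.ofReal (C * ρ ^ d) := by
  obtain ⟨C, hC0, hC⟩ := surf_stereo_preimage_le d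
  refine ⟨C + C + (C + C), by positivity, fun y ρ hρ => ?_⟩
  rw [add_mul, add_mul, ENNReal.ofReal_add (by positivity) (by positivity),
    ENNReal.ofReal_add (by positivity) (by positivity)]
  exact (measure_union_le _ _).trans (add_le_add
    ((measure_union_le _ _).trans (add_le_add (hC _ (by norm_num) _ _ hρ) (hC _ (by norm_num) _ _ hρ)))
    ((measure_union_le _ _).trans (add_le_add (hC _ (by norm_num) _ _ hρ) (hC _ (by norm_num) _ _ hρ))))

lemma mem_nearSet_of_near {N d : ℕ} {j : ℤ} {k : Fin d → ℤ} {x y : Sph d}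
    (hx : Near N j k x) (hy : Near N j k y) :
    -- Two points of one cube differ by at most `suppLen N * 2^(-j)` per coordinate; the `+ 1`
    -- ensures a positive radius.
    x ∈ nearSet ((suppLen N + 1) * (2 : ℝ) ^ (-j)) y := by
  obtain ⟨τ, hτ, hcx⟩ := hx
  obtain ⟨τ', hτ', hcy⟩ := hy
  have h : ∀ i, |stereo τ x i - stereo τ' y i| ≤ (suppLen N + 1) * (2 : ℝ) ^ (-j) := by
    intro i
    obtain ⟨h1, h2⟩ := hcx i
    obtain ⟨h3, h4⟩ := hcy i
    have h5 : (0 : ℝ) < 2 ^ j := by positivity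
    rw [zpow_neg, ← div_eq_mul_inv, le_div_iff₀ h5]
    have h6 := abs_mul (stereo τ x i - stereo τ' y i) ((2 : ℝ) ^ j)
    rw [abs_of_pos h5] at h6
    rw [← h6, abs_le]
    constructor <;> nlinarith
  rcases hτ with rfl | rfl <;> rcases hτ' with rfl | rfl
  · exact Or.inl (Or.inl h)
  · exact Or.inl (Or.inr h)
  · exact Or.inr (Or.inl h)
  · exact Or.inr (Or.inr h)

/-! ### Measurability of the kernel -/

lemma measurable_trans_aux {N d : ℕ} (hN : 2 ≤ N) (j : ℤ) (k : Fin d → ℤ) (τ : ℝ) :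
    Measurable fun u : Sph d =>
      scaledFun N d j k (stereo τ u) / Real.sqrt (jac (stereo τ u)) := by
  have h1 : Measurable (scaledFun N d j k) := by
    refine Continuous.measurable ?_
    unfold scaledFun
    have := continuous_scalingFun hN
    fun_prop
  have h2 : Measurable (jac : (Fin d → ℝ) → ℝ) := by
    unfold jac
    fun_prop
  exact (h1.comp (measurable_stereo τ)).div (h2.comp (measurable_stereo τ)).sqrt

lemma measurable_aww {d : ℕ} (δ : ℝ) {s : ℝ → ℝ} (hs : Continuous s) {g : Sph d → ℝ}
    (hg : Measurable g) (hg' : Measurable fun u => g (reflect u)) : Measurable (aww δ s g) := by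
  unfold aww
  have ha : Measurable (angle : Sph d → ℝ) := measurable_angle
  have hs' := hs.measurable
  refine Measurable.ite (measurableSet_lt measurable_const ha) hg
    (Measurable.ite (measurableSet_lt ha measurable_const) measurable_const ?_)
  exact (((hs'.comp (ha.sub_const _)).pow_const 2).mul hg).add
    (((hs'.comp (ha.sub_const _)).mul (hs'.comp (ha.const_sub _))).mul hg')

lemma measurable_kernelTerm {N d : ℕ} (hN : 2 ≤ N) (δ : ℝ) {s : ℝ → ℝ} (hs : Continuous s)
    (j : ℤ) (y : Sph d) (k : Fin d → ℤ) :
    Measurable fun x => kernelTerm N d δ s j x y k := by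
  have hp : Measurable (transPlus (scaledFun N d j k)) := by
    refine Eq.mpr (congrArg _ (funext fun u => ?_)) (measurable_trans_aux hN j k 1)
    rw [transPlus, stereoPlus_eq]
  have hm : Measurable (transMinus (scaledFun N d j k)) := by
    refine Eq.mpr (congrArg _ (funext fun u => ?_)) (measurable_trans_aux hN j k (-1))
    rw [transMinus, stereoMinus_eq]
  unfold kernelTerm
  refine Measurable.add (Measurable.mul_const ?_ _) (Measurable.mul_const ?_ _)
  · refine hp.sub (measurable_aww δ hs hp ?_)
    simpa only [transPlus_reflect] using hm
  · refine measurable_aww δ hs hm ?_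
    simpa only [transMinus_reflect] using hp

end StereoWavelet

end

/-! ### Assembling the integral estimate -/

theorem mainTheorem5 (d : ℕ) (hd : 2 ≤ d)
    (δ : ℝ) (hδ0 : 0 < δ) (hδ1 : δ < Real.pi / 2)
    (s : ℝ → ℝ) (hs_smooth : ContDiff ℝ ((⊤ : ℕ∞) : WithTop ℕ∞) s)
    (hs_supp : tsupport s ⊆ Set.Ici (-δ))
    (hs_sq : ∀ t : ℝ, s t ^ 2 + s (-t) ^ 2 = 1)
    (ε : ℝ) (hε : 0 < ε) :
    ∀ N : ℕ, 2 ≤ N → ∃ D : ℝ, 0 < D ∧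
      ∀ y : StereoWavelet.Sph d, ∀ j : ℤ, StereoWavelet.startLevel N ε ≤ j →
        MeasureTheory.Integrable
            (fun x => StereoWavelet.kernel N d δ s ε j x y ^ 2) (StereoWavelet.surf d) ∧
          ∫ x, StereoWavelet.kernel N d δ s ε j x y ^ 2 ∂(StereoWavelet.surf d)
            ≤ D * (2 : ℝ) ^ (j * (d : ℤ)) := by
  open StereoWavelet MeasureTheory in
  intro N hN
  obtain ⟨C₁, hC₁0, hC₁⟩ := abs_kernelTerm_le N d hε δ hs_sq
  obtain ⟨C₂, hC₂0, hC₂⟩ := surf_nearSet_le d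
  set n : ℝ := 2 * ((suppLen N : ℝ) + 1) ^ d with hn
  set R : ℝ := (suppLen N : ℝ) + 1 with hR
  have hR0 : 0 < R := by positivity
  -- Here `n` bounds the number of terms, `C₁ Q` each term, and `C₂ R^d Q⁻¹` the measure of the
  -- support; the `+ 1` only makes the constant positive.
  refine ⟨(n * C₁) ^ 2 * (C₂ * R ^ d) + 1, by positivity, fun y j _ => ?_⟩
  set Q : ℝ := (2 : ℝ) ^ (j * (d : ℤ)) with hQ
  have hQ0 : 0 < Q := by positivity
  obtain ⟨F, hFcard, hFcubes, hF⟩ := kernel_eq_sum (δ := δ) hN hs_sq ε j y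
  set ρ : ℝ := R * (2 : ℝ) ^ (-j) with hρ
  have hρ0 : 0 < ρ := by positivity
  have hρd : ρ ^ d = R ^ d * Q⁻¹ := by
    rw [hρ, mul_pow, hQ, zpow_mul, zpow_natCast, zpow_neg, inv_pow]
  have hmeas : Measurable fun x => kernel N d δ s ε j x y := by
    simp only [hF]
    exact Finset.measurable_sum _ fun k _ =>
      measurable_kernelTerm hN δ hs_smooth.continuous j y k
  have hbound : ∀ x, ‖kernel N d δ s ε j x y ^ 2‖
      ≤ (nearSet ρ y).indicator (fun _ => (n * C₁ * Q) ^ 2) x := by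
    intro x
    rw [Real.norm_of_nonneg (sq_nonneg _)]
    by_cases hx : x ∈ nearSet ρ y
    · rw [Set.indicator_of_mem hx, sq_le_sq, abs_of_nonneg (by positivity : 0 ≤ n * C₁ * Q), hF]
      refine (Finset.abs_sum_le_sum_abs _ _).trans
        ((Finset.sum_le_card_nsmul _ _ _ fun k hk => hC₁ j k (hFcubes k hk) x y).trans ?_)
      rw [nsmul_eq_mul, mul_assoc n]
      refine mul_le_mul_of_nonneg_right ?_ (by positivity)
      rw [hn, hR]
      exact_mod_cast hFcard
    · rw [Set.indicator_of_notMem hx, hF, Finset.sum_eq_zero]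
      · norm_num
      · exact fun k _ => kernelTerm_eq_zero hN hs_sq fun h => hx (mem_nearSet_of_near h.1 h.2)
  have hfin : surf d (nearSet ρ y) < ⊤ := (hC₂ y ρ hρ0).trans_lt ENNReal.ofReal_lt_top
  have hint : Integrable ((nearSet ρ y).indicator fun _ => (n * C₁ * Q) ^ 2) (surf d) :=
    (integrable_indicator_iff (measurableSet_nearSet ρ y)).mpr (integrableOn_const hfin.ne)
  have hI : Integrable (fun x => kernel N d δ s ε j x y ^ 2) (surf d) :=
    hint.mono' (hmeas.pow_const 2).aestronglyMeasurable (Filter.Eventually.of_forall hbound)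
  refine ⟨hI, ?_⟩
  calc ∫ x, kernel N d δ s ε j x y ^ 2 ∂(surf d)
      ≤ ∫ x, (nearSet ρ y).indicator (fun _ => (n * C₁ * Q) ^ 2) x ∂(surf d) :=
        integral_mono hI hint fun x => (le_abs_self _).trans (hbound x)
    _ = (surf d).real (nearSet ρ y) * (n * C₁ * Q) ^ 2 := by
        rw [integral_indicator (measurableSet_nearSet ρ y), setIntegral_const, smul_eq_mul]
    _ ≤ C₂ * ρ ^ d * (n * C₁ * Q) ^ 2 := by
        gcongr
        exact ENNReal.toReal_le_of_le_ofReal (by positivity) (hC₂ y ρ hρ0)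
    _ = (n * C₁) ^ 2 * (C₂ * R ^ d) * Q := by
        rw [hρd]; field_simp
    _ ≤ ((n * C₁) ^ 2 * (C₂ * R ^ d) + 1) * Q := by gcongr; linarith
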